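/- Let $(N,h)$ be a compact smooth Riemannian manifold (without boundary), with volume measure $dq$. Let $f_k$ ($k\in\mathbb N$) be a bounded sequence of functions in the Sobolev space $W^{1,2}(N)$ such that $f_k-f_{k'}\in L^\infty(N)$ for all $k,k'$, and $f_k-f_{k'}\to 0$ in $L^\infty(N)$ as $k,k'\to\infty$. Assume that there is a constant $C>0$ such that one of the following holds. (a) $\Delta f_k\le C$ for all $k$ in the weak sense, i.e. $\int_N\nabla f_k\cdot\nabla\phi\,dq\ge -C\int_N\phi\,dq$ for all $k$ and all nonnegative $\phi\in W^{1,2}(N)$. (b) $\Delta f_k\ge -C$ for all $k$ in the weak sense, i.e. $\int_N\nabla f_k\cdot\nabla\phi\,dq\le C\int_N\phi\,dq$ for all $k$ and all nonnegative $\phi\in W^{1,2}(N)$. Then there is a function $f\in W^{1,2}(N)$ such that $f_k\to f$ strongly in $W^{1,2}(N)$, and, for this $f$, $$\int_N|\nabla f_k|^2\,\eta\,dq\;\longrightarrow\;\int_N|\nabla f|^2\,\eta\,dq\qquad\text{for every }\eta\in L^\infty(N).$$ -/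

import Mathlib

open scoped Manifold ContDiff ENNReal NNReal Topology
open MeasureTheory Bundle Filter

noncomputable section

namespace RiemSobolev

/-- The model space `ℝⁿ` (Euclidean norm, Lebesgue measure `volume`). -/
abbrev Eu (n : ℕ) : Type := EuclideanSpace ℝ (Fin n)

/-- A smooth Riemannian metric on a smooth `n`-manifold `N` without boundary: a smooth, symmetric,
positive definite section of the bilinear forms on the tangent bundle. -/
abbrev Metric (n : ℕ) (N : Type*) [TopologicalSpace N] [ChartedSpace (Eu n) N]
    [IsManifold 𝓘(ℝ, Eu n) ∞ N] :=
  ContMDiffRiemannianMetric 𝓘(ℝ, Eu n) ∞ (Eu n) (fun p : N ↦ TangentSpace 𝓘(ℝ, Eu n) p)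

variable {n : ℕ} {N : Type*} [TopologicalSpace N] [ChartedSpace (Eu n) N]

/-- The inverse `ℝⁿ ⊇ target → N` of the chart around `x`. -/
def param (x : N) : Eu n → N := (extChartAt 𝓘(ℝ, Eu n) x).symm

/-- The open subset of `ℝⁿ` on which the chart around `x` takes its values. -/
def chartDomain (x : N) : Set (Eu n) := (extChartAt 𝓘(ℝ, Eu n) x).target

/-- The coordinate vector `∂_v` of the chart around `x`, at the point with coordinates `y`:
the image of `v` under the differential of the inverse chart. -/
def coordVec (x : N) (y v : Eu n) : TangentSpace 𝓘(ℝ, Eu n) (param x y) :=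
  mfderiv 𝓘(ℝ, Eu n) 𝓘(ℝ, Eu n) (param x) y v

variable [IsManifold 𝓘(ℝ, Eu n) ∞ N]

/-- The coefficients `h_ij(y) = h(∂_i, ∂_j)` of the metric in the chart around `x`. -/
def gram (h : Metric n N) (x : N) (y : Eu n) : Matrix (Fin n) (Fin n) ℝ :=
  Matrix.of fun i j ↦ h.inner (param x y)
    (coordVec x y (EuclideanSpace.single i 1)) (coordVec x y (EuclideanSpace.single j 1))

/-- The Riemannian measure in the chart around `x`, i.e. `√(det h_ij) dy¹ ⋯ dyⁿ`, carried to `N`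
by the inverse chart. -/
def chartVolume [MeasurableSpace N] (h : Metric n N) (x : N) : Measure N :=
  Measure.map (param x)
    ((volume.restrict (chartDomain x)).withDensity
      fun y ↦ ENNReal.ofReal (Real.sqrt (gram h x y).det))

/-- The Riemannian measure `dq` of `h`: the least measure that dominates `√(det h_ij) dy` in every
chart. By the change of variables formula the measures of any two charts agree on the overlap,
so that this is the measure whose restriction to each chart is `√(det h_ij) dy`. -/
def vol [MeasurableSpace N] (h : Metric n N) : Measure N :=
  ⨆ x : N, chartVolume h x

/-- The components `y ↦ h(X, ∂_v)` of a vector field in the chart around `x` (that is, of the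
`1`-form dual to `X`). -/
def chartComponent (h : Metric n N) (X : Π p : N, TangentSpace 𝓘(ℝ, Eu n) p)
    (x : N) (v y : Eu n) : ℝ :=
  h.inner (param x y) (X (param x y)) (coordVec x y v)

/-- A (not necessarily continuous) vector field is measurable up to null sets if its components in
all charts are. -/
def AEMeasurableField (h : Metric n N) (X : Π p : N, TangentSpace 𝓘(ℝ, Eu n) p) : Prop :=
  ∀ (x : N) (v : Eu n), AEMeasurable (chartComponent h X x v) (volume.restrict (chartDomain x))

/-- `X` is the weak gradient of `f`: in every chart, `h(X, ∂_v)` is the weak partial derivative of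
`f` in the direction `v`, tested against smooth functions with compact support in the chart. -/
def IsWeakGradient (h : Metric n N) (f : N → ℝ) (X : Π p : N, TangentSpace 𝓘(ℝ, Eu n) p) : Prop :=
  ∀ (x : N) (v : Eu n) (ψ : Eu n → ℝ), ContDiff ℝ ∞ ψ → HasCompactSupport ψ →
    tsupport ψ ⊆ chartDomain x →
    ∫ y, f (param x y) * fderiv ℝ ψ y v = - ∫ y, chartComponent h X x v y * ψ y

variable [MeasurableSpace N]

/-- A function in `W^{1,2}(N)`: a square integrable function (a representative of its class modulo
null sets) together with (a representative of) its square integrable weak gradient. -/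
structure W12 (h : Metric n N) where
  toFun : N → ℝ
  grad : Π p : N, TangentSpace 𝓘(ℝ, Eu n) p
  memLp : MemLp toFun 2 (vol h)
  measurable_grad : AEMeasurableField h grad
  integrable_grad_sq : Integrable (fun p ↦ h.inner p (grad p) (grad p)) (vol h)
  isWeakGradient : IsWeakGradient h toFun grad

instance (h : Metric n N) : CoeFun (W12 h) (fun _ ↦ N → ℝ) := ⟨W12.toFun⟩

/-- The `W^{1,2}` norm `(∫ f² dq + ∫ |X|² dq)^{1/2}` of a function `f` with weak gradient `X`. -/
def sobolevNorm (h : Metric n N) (f : N → ℝ) (X : Π p : N, TangentSpace 𝓘(ℝ, Eu n) p) : ℝ≥0∞ :=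
  ((∫⁻ p, ENNReal.ofReal (f p ^ 2) ∂vol h) +
    ∫⁻ p, ENNReal.ofReal (h.inner p (X p) (X p)) ∂vol h) ^ (1 / 2 : ℝ)

namespace W12

variable {h : Metric n N}

/-- The norm of `u` in `W^{1,2}(N)`. -/
def norm (u : W12 h) : ℝ≥0∞ := sobolevNorm h u u.grad

/-- The distance `‖u - w‖` in `W^{1,2}(N)`; `u - w` has the weak gradient `∇u - ∇w`. -/
def dist (u w : W12 h) : ℝ≥0∞ :=
  sobolevNorm h (fun p ↦ u p - w p) (fun p ↦ u.grad p - w.grad p)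

/-- The pairing `∫ ∇u · ∇w dq`. -/
def dirichlet (u w : W12 h) : ℝ := ∫ p, h.inner p (u.grad p) (w.grad p) ∂vol h

/-- The function `|∇u|²`. -/
def gradSq (u : W12 h) (p : N) : ℝ := h.inner p (u.grad p) (u.grad p)

/-- `Δu ≤ c` in the weak sense: `∫ ∇u · ∇φ dq ≥ -c ∫ φ dq` for all nonnegative `φ` in
`W^{1,2}(N)`. -/
def LaplacianLE (u : W12 h) (c : ℝ) : Prop :=
  ∀ φ : W12 h, (∀ᵐ p ∂vol h, 0 ≤ φ p) → u.dirichlet φ ≥ -c * ∫ p, φ p ∂vol h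

/-- `Δu ≥ c` in the weak sense: `∫ ∇u · ∇φ dq ≤ -c ∫ φ dq` for all nonnegative `φ` in
`W^{1,2}(N)`. -/
def LaplacianGE (u : W12 h) (c : ℝ) : Prop :=
  ∀ φ : W12 h, (∀ᵐ p ∂vol h, 0 ≤ φ p) → u.dirichlet φ ≤ -c * ∫ p, φ p ∂vol h

end W12

end RiemSobolev

end

/-! The key is an energy estimate. If `|u - w| ≤ ε` almost everywhere, then `u - w + ε` and `w - u +
ε` are both nonnegative, hence admissible in the one-sided Laplacian bounds. Testing the bound for
one of `u`, `w` with one of them, the bound for the other with the other, and adding, the gradient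
terms combine to `±∫ |∇u - ∇w|²`, while the test functions add up to the constant `2ε`. Hence `∫ |∇u
- ∇w|² ≤ 2Cε vol(N)` (`W12.integral_inner_sub_le`), and a sequence that is Cauchy in `L^∞` has
gradients that are Cauchy in `L²`.

Since the volume is finite, the functions themselves converge in `L²` (`exists_memLp_two_limit`).
The gradients converge because square integrable fields are complete (`exists_limit_field`), and the
limit field is the weak gradient of the limit function because both sides of the defining identity
are continuous under `L¹` convergence (`isWeakGradient_of_tendsto`). Finally `|∇f_k|² - |∇f|² =
|∇f_k - ∇f|² + 2⟨∇f_k - ∇f, ∇f⟩` tends to `0` in `L¹`, which allows pairing with any bounded `η`.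

The geometric input is that `vol h` is finite, that its null sets and integrals can be compared with
Lebesgue measure in charts, and that inner products of measurable fields are measurable. -/

noncomputable section

namespace RiemSobolev

set_option linter.unusedSectionVars false

/-! ### Charts, coordinate vectors and the Gram matrix. -/

section Chart

variable {n : ℕ} {N : Type*} [TopologicalSpace N] [ChartedSpace (Eu n) N]

lemma isOpen_chartDomain (x : N) : IsOpen (chartDomain x : Set (Eu n)) :=
  isOpen_extChartAt_target x

lemma continuousOn_param (x : N) : ContinuousOn (param x : Eu n → N) (chartDomain x) :=
  continuousOn_extChartAt_symm x

lemma injOn_param (x : N) : Set.InjOn (param x : Eu n → N) (chartDomain x) :=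
  (extChartAt 𝓘(ℝ, Eu n) x).symm.injOn

lemma param_mem_source {x : N} {y : Eu n} (hy : y ∈ chartDomain x) :
    param x y ∈ (extChartAt 𝓘(ℝ, Eu n) x).source :=
  (extChartAt 𝓘(ℝ, Eu n) x).map_target hy

lemma param_extChartAt {x p : N} (hp : p ∈ (extChartAt 𝓘(ℝ, Eu n) x).source) :
    param x (extChartAt 𝓘(ℝ, Eu n) x p) = p :=
  (extChartAt 𝓘(ℝ, Eu n) x).left_inv hp

lemma extChartAt_param {x : N} {y : Eu n} (hy : y ∈ chartDomain x) :
    extChartAt 𝓘(ℝ, Eu n) x (param x y) = y :=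
  (extChartAt 𝓘(ℝ, Eu n) x).right_inv hy

lemma measurableSet_inter_preimage_of_continuousOn {α β : Type*} [TopologicalSpace α]
    [MeasurableSpace α] [OpensMeasurableSpace α] [TopologicalSpace β] [MeasurableSpace β]
    [BorelSpace β] {g : α → β} {s : Set α} (hg : ContinuousOn g s) (hs : MeasurableSet s)
    {A : Set β} (hA : MeasurableSet A) : MeasurableSet (s ∩ g ⁻¹' A) := by
  have h1 : Measurable (s.domRestrict g) :=
    (continuousOn_iff_continuous_domRestrict.1 hg).measurable
  convert hs.subtype_image (h1 hA) using 1
  ext y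
  simp [Set.domRestrict, and_comm]

lemma measurableSet_source [MeasurableSpace N] [BorelSpace N] (x : N) :
    MeasurableSet (extChartAt 𝓘(ℝ, Eu n) x).source :=
  (isOpen_extChartAt_source x).measurableSet

/-- `v ↦ ∂_v` as a linear map from `ℝⁿ`. -/
def coordVecL (x : N) (y : Eu n) : Eu n →L[ℝ] TangentSpace 𝓘(ℝ, Eu n) (param x y) :=
  mfderiv 𝓘(ℝ, Eu n) 𝓘(ℝ, Eu n) (param x) y

lemma coordVecL_apply (x : N) (y v : Eu n) : coordVecL x y v = coordVec x y v := rfl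

lemma coordVec_eq_sum (x : N) (y v : Eu n) :
    coordVec x y v = ∑ i, v i • coordVec x y (EuclideanSpace.single i 1) := by
  simp only [← coordVecL_apply]
  conv_lhs => rw [← (EuclideanSpace.basisFun (Fin n) ℝ).sum_repr v]
  simp only [map_sum, map_smul, EuclideanSpace.basisFun_repr, EuclideanSpace.basisFun_apply]

variable [IsManifold 𝓘(ℝ, Eu n) ∞ N]

lemma mdifferentiableAt_param {x : N} {y : Eu n} (hy : y ∈ chartDomain x) :
    MDifferentiableAt 𝓘(ℝ, Eu n) 𝓘(ℝ, Eu n) (param x) y := by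
  have : IsManifold 𝓘(ℝ, Eu n) 1 N := IsManifold.of_le (n := ∞) (by simp)
  have h := mdifferentiableWithinAt_extChartAt_symm (I := 𝓘(ℝ, Eu n)) (x := x) hy
  rw [modelWithCornersSelf_coe, Set.range_id, mdifferentiableWithinAt_univ] at h
  exact h

lemma isInvertible_mfderiv_param {x : N} {y : Eu n} (hy : y ∈ chartDomain x) :
    (mfderiv 𝓘(ℝ, Eu n) 𝓘(ℝ, Eu n) (param x) y).IsInvertible := by
  have : IsManifold 𝓘(ℝ, Eu n) 1 N := IsManifold.of_le (n := ∞) (by simp)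
  have h := isInvertible_mfderivWithin_extChartAt_symm (I := 𝓘(ℝ, Eu n)) (x := x) hy
  rw [modelWithCornersSelf_coe, Set.range_id, mfderivWithin_univ] at h
  exact h

lemma coordVec_bijective {x : N} {y : Eu n} (hy : y ∈ chartDomain x) :
    Function.Bijective (fun v : Eu n ↦ coordVec x y v) :=
  (isInvertible_mfderiv_param hy).bijective

lemma contMDiffOn_param (x : N) :
    ContMDiffOn 𝓘(ℝ, Eu n) 𝓘(ℝ, Eu n) ∞ (param x : Eu n → N) (chartDomain x) :=
  contMDiffOn_extChartAt_symm x

/-- The tangent map of the inverse chart is continuous; here it is evaluated along the constant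
section `v`. The total space is needed because the fibre varies with `y`. -/
lemma continuousOn_coordVec (x : N) (v : Eu n) :
    ContinuousOn (fun y : Eu n ↦ (⟨param x y, coordVec x y v⟩ : TangentBundle 𝓘(ℝ, Eu n) N))
      (chartDomain x) := by
  have : IsManifold 𝓘(ℝ, Eu n) 1 N := IsManifold.of_le (n := ∞) (by simp)
  have h := (contMDiffOn_param (n := n) x).continuousOn_tangentMapWithin (by simp)
    (isOpen_chartDomain x).uniqueMDiffOn
  have h2 : Continuous (fun y : Eu n ↦ (⟨y, v⟩ : TangentBundle 𝓘(ℝ, Eu n) (Eu n))) :=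
    (tangentBundleModelSpaceHomeomorph 𝓘(ℝ, Eu n)).symm.continuous.comp
      (Continuous.prodMk continuous_id continuous_const)
  refine (h.comp h2.continuousOn (s := chartDomain x) fun y hy ↦ hy).congr fun y hy ↦ ?_
  simp only [tangentMapWithin, Function.comp, coordVec]
  rw [mfderivWithin_of_isOpen (isOpen_chartDomain x) hy]

lemma continuousOn_inner_coordVec (h : Metric n N) (x : N) (v w : Eu n) :
    ContinuousOn (fun y ↦ h.inner (param x y) (coordVec x y v) (coordVec x y w))
      (chartDomain x) := by
  have h1 : ContinuousOn (fun y : Eu n ↦ TotalSpace.mk' (Eu n →L[ℝ] Eu n →L[ℝ] ℝ)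
      (E := fun p : N ↦ (TangentSpace 𝓘(ℝ, Eu n) p →L[ℝ] TangentSpace 𝓘(ℝ, Eu n) p →L[ℝ] ℝ))
      (param x y) (h.inner (param x y))) (chartDomain x) :=
    h.contMDiff.continuous.comp_continuousOn (continuousOn_param x)
  have h2 := ContinuousOn.clm_bundle_apply₂ (𝕜 := ℝ) (E₃ := fun _ : N ↦ ℝ) (F₃ := ℝ)
    (b := param x) h1 (continuousOn_coordVec x v) (continuousOn_coordVec x w)
  intro y hy
  have := h2 y hy
  rw [FiberBundle.continuousWithinAt_totalSpace] at this
  simpa using this.2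

lemma inner_self_nonneg (h : Metric n N) (p : N) (v : TangentSpace 𝓘(ℝ, Eu n) p) :
    0 ≤ h.inner p v v := by
  rcases eq_or_ne v 0 with rfl | hv
  · simp
  · exact (h.pos p v hv).le

lemma inner_coordVec (h : Metric n N) (x : N) (y v w : Eu n) :
    h.inner (param x y) (coordVec x y v) (coordVec x y w) =
      v.ofLp ⬝ᵥ (gram h x y).mulVec w.ofLp := by
  rw [coordVec_eq_sum x y v, coordVec_eq_sum x y w]
  simp only [map_sum, map_smul, sum_apply, smul_apply,
    dotProduct, Matrix.mulVec, gram, Matrix.of_apply, smul_eq_mul, Finset.mul_sum]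
  rw [Finset.sum_comm]
  exact Finset.sum_congr rfl fun i _ ↦ Finset.sum_congr rfl fun j _ ↦ by ring

lemma gram_posDef (h : Metric n N) {x : N} {y : Eu n} (hy : y ∈ chartDomain x) :
    (gram h x y).PosDef := by
  refine Matrix.PosDef.of_dotProduct_mulVec_pos ?_ fun {v} hv ↦ ?_
  · ext i j
    simp [gram, h.symm]
  · have := inner_coordVec h x y (WithLp.toLp 2 v) (WithLp.toLp 2 v)
    simp only [star_trivial]
    rw [← this]
    refine h.pos _ _ fun h0 ↦ hv ?_
    have := (coordVec_bijective hy).1 (a₁ := WithLp.toLp 2 v) (a₂ := 0) 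
      (h0.trans (map_zero (coordVecL x y)).symm)
    simpa using this

lemma gram_det_pos (h : Metric n N) {x : N} {y : Eu n} (hy : y ∈ chartDomain x) :
    0 < (gram h x y).det := (gram_posDef h hy).det_pos

lemma continuousOn_gram (h : Metric n N) (x : N) : ContinuousOn (gram h x) (chartDomain x) :=
  continuousOn_pi.2 fun _ ↦ continuousOn_pi.2 fun _ ↦ continuousOn_inner_coordVec h x _ _

lemma continuousOn_gram_det (h : Metric n N) (x : N) :
    ContinuousOn (fun y ↦ (gram h x y).det) (chartDomain x) :=
  Continuous.comp_continuousOn (g := Matrix.det) (continuous_id.matrix_det) (continuousOn_gram h x)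

/-- Cramer's rule: the determinant is continuous and nonzero on the chart domain. -/
lemma continuousOn_gram_inv (h : Metric n N) (x : N) (i j : Fin n) :
    ContinuousOn (fun y ↦ (gram h x y)⁻¹ i j) (chartDomain x) := by
  have h1 : ContinuousOn (fun y ↦ (gram h x y).det⁻¹ * (gram h x y).adjugate i j)
      (chartDomain x) := by
    refine ((continuousOn_gram_det h x).inv₀ fun y hy ↦ (gram_det_pos h hy).ne').mul ?_
    exact Continuous.comp_continuousOn (g := fun M : Matrix (Fin n) (Fin n) ℝ ↦ M.adjugate i j)
      (continuous_id.matrix_adjugate.matrix_elem i j) (continuousOn_gram h x)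
  refine h1.congr fun y _ ↦ ?_
  simp [Matrix.inv_def]

end Chart

/-! ### Change of charts and finiteness of the Riemannian volume. -/

section ChangeOfCharts

variable {n : ℕ} {N : Type*} [TopologicalSpace N] [ChartedSpace (Eu n) N]
  [IsManifold 𝓘(ℝ, Eu n) ∞ N]

/-- The change of coordinates from the chart around `x` to the chart around `x'`. -/
def transition (x x' : N) : Eu n → Eu n := fun y ↦ extChartAt 𝓘(ℝ, Eu n) x' (param x y)

/-- All tangent spaces are definitionally the model space, so a vector can be kept fixed while the
base point is rewritten. -/
lemma inner_congr (h : Metric n N) {p q : N} (hpq : p = q) (v w : Eu n) :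
    h.inner p (v : TangentSpace 𝓘(ℝ, Eu n) p) (w : TangentSpace 𝓘(ℝ, Eu n) p) =
      h.inner q (v : TangentSpace 𝓘(ℝ, Eu n) q) (w : TangentSpace 𝓘(ℝ, Eu n) q) := by
  subst hpq; rfl

lemma differentiableAt_transition {x x' : N} {y : Eu n} (hy : y ∈ chartDomain x)
    (hy' : param x y ∈ (extChartAt 𝓘(ℝ, Eu n) x').source) :
    DifferentiableAt ℝ (transition x x') y := by
  have : IsManifold 𝓘(ℝ, Eu n) 1 N := IsManifold.of_le (n := ∞) (by simp)
  rw [← mdifferentiableAt_iff_differentiableAt]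
  refine MDifferentiableAt.comp (I' := 𝓘(ℝ, Eu n)) y ?_ (mdifferentiableAt_param hy)
  exact mdifferentiableAt_extChartAt (by simpa using hy')

lemma transition_mem {x x' : N} {y : Eu n}
    (hy' : param x y ∈ (extChartAt 𝓘(ℝ, Eu n) x').source) :
    transition x x' y ∈ chartDomain x' := (extChartAt 𝓘(ℝ, Eu n) x').map_source hy'

lemma param_transition {x x' : N} {y : Eu n}
    (hy' : param x y ∈ (extChartAt 𝓘(ℝ, Eu n) x').source) :
    param x' (transition x x' y) = param x y := (extChartAt 𝓘(ℝ, Eu n) x').left_inv hy'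

lemma coordVec_transition {x x' : N} {y : Eu n} (hy : y ∈ chartDomain x)
    (hy' : param x y ∈ (extChartAt 𝓘(ℝ, Eu n) x').source) (v : Eu n) :
    (coordVec x y v : Eu n) =
      (coordVec x' (transition x x' y) (fderiv ℝ (transition x x') y v) : Eu n) := by
  have hev : (param x' ∘ transition x x') =ᶠ[𝓝 y] param x := by
    have h1 : ∀ᶠ z in 𝓝 y, param x z ∈ (extChartAt 𝓘(ℝ, Eu n) x').source :=
      ((continuousOn_param x).continuousAt ((isOpen_chartDomain x).mem_nhds hy)).eventually_mem
        ((isOpen_extChartAt_source x').mem_nhds hy')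
    filter_upwards [h1] with z hz using param_transition hz
  have h2 := mfderiv_comp (I := 𝓘(ℝ, Eu n)) (I' := 𝓘(ℝ, Eu n)) (I'' := 𝓘(ℝ, Eu n)) y
    (mdifferentiableAt_param (transition_mem hy'))
    (differentiableAt_transition hy hy').mdifferentiableAt
  have h3 := hev.mfderiv_eq (I := 𝓘(ℝ, Eu n)) (I' := 𝓘(ℝ, Eu n))
  unfold coordVec
  rw [mfderiv_eq_fderiv] at h2
  have h4 : (mfderiv 𝓘(ℝ, Eu n) 𝓘(ℝ, Eu n) (param x) y : Eu n →L[ℝ] Eu n) =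
    (mfderiv 𝓘(ℝ, Eu n) 𝓘(ℝ, Eu n) (param x' ∘ transition x x') y : Eu n →L[ℝ] Eu n) := h3.symm
  exact DFunLike.congr_fun (h4.trans h2) v

lemma inner_coordVec_transition (h : Metric n N) {x x' : N} {y : Eu n} (hy : y ∈ chartDomain x)
    (hy' : param x y ∈ (extChartAt 𝓘(ℝ, Eu n) x').source) (v w : Eu n) :
    h.inner (param x y) (coordVec x y v) (coordVec x y w) =
      h.inner (param x' (transition x x' y))
        (coordVec x' (transition x x' y) (fderiv ℝ (transition x x') y v))
        (coordVec x' (transition x x' y) (fderiv ℝ (transition x x') y w)) := by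
  exact (inner_congr h (param_transition hy').symm _ _).trans
    (congrArg₂ (fun a b : Eu n ↦ h.inner (param x' (transition x x' y)) a b)
      (coordVec_transition hy hy' v) (coordVec_transition hy hy' w))

lemma sqrt_gram_det_transition (h : Metric n N) {x x' : N} {y : Eu n} (hy : y ∈ chartDomain x)
    (hy' : param x y ∈ (extChartAt 𝓘(ℝ, Eu n) x').source) :
    Real.sqrt (gram h x y).det =
      |(fderiv ℝ (transition x x') y).det| * Real.sqrt (gram h x' (transition x x' y)).det := by
  set J := LinearMap.toMatrix (EuclideanSpace.basisFun (Fin n) ℝ).toBasis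
    (EuclideanSpace.basisFun (Fin n) ℝ).toBasis
    (fderiv ℝ (transition x x') y : Eu n →ₗ[ℝ] Eu n) with hJ
  have hdet : (fderiv ℝ (transition x x') y).det = J.det := by
    rw [hJ, LinearMap.det_toMatrix]
  have hcol : ∀ i, (fderiv ℝ (transition x x') y (EuclideanSpace.single i 1)).ofLp =
      fun k ↦ J k i := by
    intro i
    ext k
    simp [hJ, LinearMap.toMatrix_apply]
  -- The metric pulls back as `Jᵀ G' J`, so its determinant acquires the factor `(det J)²`, whose
  -- root is `|det J|`.
  have hG : gram h x y = J.transpose * gram h x' (transition x x' y) * J := by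
    ext i j
    have := inner_coordVec_transition h hy hy' (EuclideanSpace.single i 1)
      (EuclideanSpace.single j 1)
    rw [inner_coordVec h x' _ (fderiv ℝ (transition x x') y _), hcol, hcol] at this
    rw [gram, Matrix.of_apply, this, Matrix.mul_assoc]
    rfl
  rw [hG, hdet, Matrix.det_mul, Matrix.det_mul, Matrix.det_transpose,
    show J.det * (gram h x' (transition x x' y)).det * J.det =
      J.det ^ 2 * (gram h x' (transition x x' y)).det by ring,
    Real.sqrt_mul (sq_nonneg _), Real.sqrt_sq_eq_abs]

/-- The density `√(det h_ij)` of the Riemannian measure in the chart around `x`. -/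
def density (h : Metric n N) (x : N) (y : Eu n) : ℝ≥0∞ :=
  ENNReal.ofReal (Real.sqrt (gram h x y).det)

lemma density_pos (h : Metric n N) {x : N} {y : Eu n} (hy : y ∈ chartDomain x) :
    0 < density h x y :=
  ENNReal.ofReal_pos.2 (Real.sqrt_pos.2 (gram_det_pos h hy))

lemma continuousOn_density (h : Metric n N) (x : N) :
    ContinuousOn (density h x) (chartDomain x) :=
  ENNReal.continuous_ofReal.comp_continuousOn (continuousOn_gram_det h x).sqrt

lemma aemeasurable_density (h : Metric n N) (x : N) :
    AEMeasurable (density h x) (volume.restrict (chartDomain x)) :=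
  (continuousOn_density h x).aemeasurable (isOpen_chartDomain x).measurableSet

variable [MeasurableSpace N] [BorelSpace N]

lemma aemeasurable_param (x : N) :
    AEMeasurable (param x : Eu n → N) (volume.restrict (chartDomain x)) :=
  (continuousOn_param x).aemeasurable (isOpen_chartDomain x).measurableSet

lemma chartVolume_eq (h : Metric n N) (x : N) : chartVolume h x = Measure.map (param x)
    ((volume.restrict (chartDomain x)).withDensity (density h x)) := rfl

lemma chartVolume_apply (h : Metric n N) (x : N) {A : Set N} (hA : MeasurableSet A) :
    chartVolume h x A = ∫⁻ y in chartDomain x ∩ param x ⁻¹' A, density h x y := by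
  rw [chartVolume_eq, Measure.map_apply_of_aemeasurable
    ((aemeasurable_param x).mono_ac (withDensity_absolutelyContinuous _ _)) hA,
    withDensity_apply', Measure.restrict_restrict' (isOpen_chartDomain x).measurableSet,
    Set.inter_comm]

/-- Change of variables along the transition map, which is injective on the part of `A` seen by the
chart at `x`. Points of `A` outside that chart contribute only to the right-hand side, so only an
inequality holds. -/
lemma chartVolume_le_of_subset (h : Metric n N) (x x' : N) {A : Set N} (hA : MeasurableSet A)
    (hAx' : A ⊆ (extChartAt 𝓘(ℝ, Eu n) x').source) :
    chartVolume h x A ≤ chartVolume h x' A := by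
  rw [chartVolume_apply h x hA, chartVolume_apply h x' hA]
  set S : Set (Eu n) := chartDomain x ∩ param x ⁻¹' A
  have hS : MeasurableSet S := 
    measurableSet_inter_preimage_of_continuousOn (continuousOn_param x)
      (isOpen_chartDomain x).measurableSet hA
  have hmaps : transition x x' '' S ⊆ chartDomain x' ∩ param x' ⁻¹' A := by
    rintro _ ⟨y, hy, rfl⟩
    refine ⟨transition_mem (hAx' hy.2), ?_⟩
    rw [Set.mem_preimage, param_transition (hAx' hy.2)]
    exact hy.2
  have hinj : Set.InjOn (transition x x') S := by
    intro y hy z hz hyz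
    refine injOn_param x hy.1 hz.1 ?_
    rw [← param_transition (hAx' hy.2), ← param_transition (x' := x') (hAx' hz.2), hyz]
  calc ∫⁻ y in S, density h x y
      = ∫⁻ y in S, ENNReal.ofReal |(fderiv ℝ (transition x x') y).det| *
          density h x' (transition x x' y) := by
        refine setLIntegral_congr_fun hS fun y hy ↦ ?_
        simp only [density]
        rw [sqrt_gram_det_transition h hy.1 (hAx' hy.2), ENNReal.ofReal_mul (abs_nonneg _)]
    _ = ∫⁻ z in transition x x' '' S, density h x' z :=
        (lintegral_image_eq_lintegral_abs_det_fderiv_mul volume hS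
          (fun y hy ↦ (differentiableAt_transition hy.1
            (hAx' hy.2)).hasFDerivAt.hasFDerivWithinAt) hinj _).symm
    _ ≤ _ := lintegral_mono_set hmaps

lemma chartVolume_le_vol (h : Metric n N) (x : N) : chartVolume h x ≤ vol h :=
  le_iSup (fun x ↦ chartVolume h x) x

variable [T2Space N] [CompactSpace N]

lemma exists_finset_compact_cover (n : ℕ) (N : Type*) [TopologicalSpace N] [ChartedSpace (Eu n) N]
    [T2Space N] [CompactSpace N] : ∃ (s : Finset N) (K : N → Set N), (∀ x, IsCompact (K x)) ∧
      (∀ x, K x ⊆ (extChartAt 𝓘(ℝ, Eu n) x).source) ∧ ⋃ x ∈ s, K x = Set.univ := by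
  have h1 : ∀ x : N, ∃ K ∈ 𝓝 x, K ⊆ (extChartAt 𝓘(ℝ, Eu n) x).source ∧ IsCompact K := fun x ↦
    local_compact_nhds (extChartAt_source_mem_nhds x)
  choose K hK hKs hKc using h1
  obtain ⟨s, hs⟩ := CompactSpace.elim_nhds_subcover K hK
  exact ⟨s, K, hKc, hKs, by simpa using hs⟩

/-- Replaces the supremum over all charts by a finite sum over compact pieces. This upper bound is
enough for finiteness of the volume and for almost everywhere measurability. -/
lemma vol_le_sum (h : Metric n N) {s : Finset N} {K : N → Set N} (hKc : ∀ x, IsCompact (K x))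
    (hKs : ∀ x, K x ⊆ (extChartAt 𝓘(ℝ, Eu n) x).source) (hs : ⋃ x ∈ s, K x = Set.univ) :
    vol h ≤ ∑ x ∈ s, (chartVolume h x).restrict (K x) := by
  refine iSup_le fun x' ↦ Measure.le_iff.2 fun A hA ↦ ?_
  rw [Measure.finsetSum_apply]
  calc chartVolume h x' A ≤ chartVolume h x' (⋃ x ∈ s, A ∩ K x) := by
        refine measure_mono fun p hp ↦ ?_
        have : p ∈ ⋃ x ∈ s, K x := hs ▸ Set.mem_univ p
        simp only [Set.mem_iUnion] at this ⊢
        obtain ⟨x, hx, hpx⟩ := this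
        exact ⟨x, hx, hp, hpx⟩
    _ ≤ ∑ x ∈ s, chartVolume h x' (A ∩ K x) := measure_biUnion_finset_le _ _
    _ ≤ ∑ x ∈ s, ((chartVolume h x).restrict (K x)) A := by
        refine Finset.sum_le_sum fun x _ ↦ ?_
        rw [Measure.restrict_apply hA]
        exact chartVolume_le_of_subset h x' x (hA.inter (hKc x).measurableSet)
          (Set.inter_subset_right.trans (hKs x))

lemma chartVolume_lt_top (h : Metric n N) (x : N) {K : Set N} (hK : IsCompact K)
    (hKx : K ⊆ (extChartAt 𝓘(ℝ, Eu n) x).source) : chartVolume h x K < ⊤ := by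
  rw [chartVolume_apply h x hK.measurableSet]
  have hsub : chartDomain x ∩ param x ⁻¹' K ⊆ extChartAt 𝓘(ℝ, Eu n) x '' K :=
    fun y hy ↦ ⟨param x y, hy.2, extChartAt_param hy.1⟩
  have hcomp : IsCompact (extChartAt 𝓘(ℝ, Eu n) x '' K) :=
    hK.image_of_continuousOn ((continuousOn_extChartAt x).mono hKx)
  have hdom : extChartAt 𝓘(ℝ, Eu n) x '' K ⊆ chartDomain x := by
    rintro _ ⟨p, hp, rfl⟩
    exact (extChartAt 𝓘(ℝ, Eu n) x).map_source (hKx hp)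
  obtain ⟨M, hM⟩ := (hcomp.bddAbove_image ((continuousOn_gram_det h x).sqrt.mono hdom))
  calc ∫⁻ y in chartDomain x ∩ param x ⁻¹' K, density h x y
      ≤ ∫⁻ y in extChartAt 𝓘(ℝ, Eu n) x '' K, density h x y := lintegral_mono_set hsub
    _ ≤ ∫⁻ y in extChartAt 𝓘(ℝ, Eu n) x '' K, ENNReal.ofReal M :=
        setLIntegral_mono measurable_const fun y hy ↦
          ENNReal.ofReal_le_ofReal (hM ⟨y, hy, rfl⟩)
    _ < ⊤ := by
        rw [setLIntegral_const]
        exact ENNReal.mul_lt_top ENNReal.ofReal_lt_top hcomp.measure_lt_top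

instance isFiniteMeasure_vol (h : Metric n N) : IsFiniteMeasure (vol h) := by
  obtain ⟨s, K, hKc, hKs, hs⟩ := exists_finset_compact_cover n N
  refine ⟨(vol_le_sum h hKc hKs hs Set.univ).trans_lt ?_⟩
  rw [Measure.finsetSum_apply]
  refine ENNReal.sum_lt_top.2 fun x _ ↦ ?_
  rw [Measure.restrict_apply_univ]
  exact chartVolume_lt_top h x (hKc x) (hKs x)

end ChangeOfCharts

/-! ### Transfer of null sets, measurability and integrals between `N` and charts. -/

section Transfer

variable {n : ℕ} {N : Type*} [TopologicalSpace N] [ChartedSpace (Eu n) N]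
  [IsManifold 𝓘(ℝ, Eu n) ∞ N] [MeasurableSpace N] [BorelSpace N]

/-- Null sets of the Riemannian measure are Lebesgue null in every chart. -/
lemma map_param_absolutelyContinuous (h : Metric n N) (x : N) :
    Measure.map (param x : Eu n → N) (volume.restrict (chartDomain x)) ≪ vol h := by
  refine Measure.AbsolutelyContinuous.trans ?_
    (Measure.absolutelyContinuous_of_le (chartVolume_le_vol h x))
  rw [chartVolume_eq]
  have hm := aemeasurable_param (n := n) x
  refine Measure.AbsolutelyContinuous.mk fun A hA h0 ↦ ?_
  rw [Measure.map_apply_of_aemeasurable (hm.mono_ac (withDensity_absolutelyContinuous _ _)) hA]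
    at h0
  rw [Measure.map_apply_of_aemeasurable hm hA]
  refine withDensity_absolutelyContinuous' (aemeasurable_density h x) ?_ h0
  exact ae_restrict_of_forall_mem (isOpen_chartDomain x).measurableSet
    fun y hy ↦ (density_pos h hy).ne'

lemma ae_param_of_ae_vol (h : Metric n N) (x : N) {P : N → Prop} (hP : ∀ᵐ p ∂vol h, P p) :
    ∀ᵐ y ∂(volume.restrict (chartDomain x)), P (param (n := n) x y) :=
  ae_of_ae_map (aemeasurable_param x) ((map_param_absolutelyContinuous h x).ae_le hP)

lemma aemeasurable_comp_param (h : Metric n N) (x : N) {β : Type*} [MeasurableSpace β]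
    {F : N → β} (hF : AEMeasurable F (vol h)) :
    AEMeasurable (fun y ↦ F (param (n := n) x y)) (volume.restrict (chartDomain x)) :=
  (hF.mono_ac (map_param_absolutelyContinuous h x)).comp_aemeasurable (aemeasurable_param x)

lemma aemeasurable_chartVolume_of_comp_param (h : Metric n N) (x : N) {F : N → ℝ}
    (hF : AEMeasurable (fun y ↦ F (param (n := n) x y)) (volume.restrict (chartDomain x))) :
    AEMeasurable F (chartVolume h x) := by
  classical
  set G := hF.mk
  have hG : Measurable G := hF.measurable_mk
  set S := (extChartAt 𝓘(ℝ, Eu n) x).source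
  have hS : MeasurableSet S := measurableSet_source x
  -- The representative on `N` is `G` composed with the chart, extended by zero off the source.
  have hF' : Measurable (S.piecewise (fun p ↦ G (extChartAt 𝓘(ℝ, Eu n) x p)) fun _ ↦ 0) := by
    refine measurable_of_restrict_of_restrict_compl hS ?_ ?_
    · rw [Set.domRestrict_piecewise]
      exact hG.comp (continuousOn_iff_continuous_domRestrict.1 (continuousOn_extChartAt x)).measurable
    · rw [Set.domRestrict_piecewise_compl]
      exact measurable_const
  set μ : Measure (Eu n) := volume.restrict (chartDomain x)
  -- A measurable null hull of the exceptional set, so that its preimage under the chart is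
  -- measurable in `N`.
  set Z := toMeasurable μ {y | F (param x y) ≠ G y}
  have hZ : μ Z = 0 := (measure_toMeasurable _).trans hF.ae_eq_mk
  have hB : MeasurableSet (Sᶜ ∪ S ∩ extChartAt 𝓘(ℝ, Eu n) x ⁻¹' Z) :=
    hS.compl.union (measurableSet_inter_preimage_of_continuousOn (continuousOn_extChartAt x) hS
      (measurableSet_toMeasurable _ _))
  refine ⟨_, hF', ?_⟩
  have hm := (aemeasurable_param (n := n) x).mono_ac
    (withDensity_absolutelyContinuous μ (density h x))
  have hnull : chartVolume h x (Sᶜ ∪ S ∩ extChartAt 𝓘(ℝ, Eu n) x ⁻¹' Z) = 0 := by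
    rw [chartVolume_eq, Measure.map_apply_of_aemeasurable hm hB]
    refine withDensity_absolutelyContinuous μ (density h x) ?_
    have h1 : ∀ᵐ y ∂μ, y ∉ Z := measure_eq_zero_iff_ae_notMem.1 hZ
    refine measure_eq_zero_iff_ae_notMem.2 ?_
    filter_upwards [h1, ae_restrict_mem (isOpen_chartDomain x).measurableSet] with y hyZ hy hyB
    rcases hyB with hyB | hyB
    · exact hyB (param_mem_source hy)
    · refine hyZ ?_
      have := hyB.2
      rwa [Set.mem_preimage, extChartAt_param hy] at this
  filter_upwards [measure_eq_zero_iff_ae_notMem.1 hnull] with p hp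
  simp only [Set.mem_union, Set.mem_compl_iff, Set.mem_inter_iff, Set.mem_preimage, not_or,
    not_not, not_and] at hp
  rw [Set.piecewise_eq_of_mem _ _ _ hp.1]
  by_contra hne
  refine hp.2 hp.1 (subset_toMeasurable _ _ ?_)
  rw [Set.mem_ofPred_eq, param_extChartAt hp.1]
  exact hne

lemma aemeasurable_of_comp_param [T2Space N] [CompactSpace N] (h : Metric n N) {F : N → ℝ}
    (hF : ∀ x, AEMeasurable (fun y ↦ F (param (n := n) x y)) (volume.restrict (chartDomain x))) :
    AEMeasurable F (vol h) := by
  obtain ⟨s, K, hKc, hKs, hs⟩ := exists_finset_compact_cover n N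
  refine AEMeasurable.mono_measure ?_ (vol_le_sum h hKc hKs hs)
  have : ∀ t : Finset N, AEMeasurable F (∑ x ∈ t, (chartVolume h x).restrict (K x)) := by
    classical
    intro t
    induction t using Finset.induction_on with
    | empty => simp
    | insert a t ha ih =>
      rw [Finset.sum_insert ha]
      exact ((aemeasurable_chartVolume_of_comp_param h a (hF a)).restrict).add_measure ih
  exact this s

/-- On compact subsets of a chart, Lebesgue measure is dominated by the Riemannian measure. -/
lemma exists_setLIntegral_param_le (h : Metric n N) (x : N) {K : Set (Eu n)} (hK : IsCompact K)
    (hKx : K ⊆ chartDomain x) : ∃ c : ℝ≥0∞, c ≠ ⊤ ∧ ∀ F : N → ℝ≥0∞, AEMeasurable F (vol h) →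
      ∫⁻ y in K, F (param (n := n) x y) ≤ c * ∫⁻ p, F p ∂vol h := by
  -- `ρ` is the minimum of the positive continuous density on `K`; the required constant is `ρ⁻¹`.
  obtain ⟨ρ, hρ, hρK⟩ : ∃ ρ : ℝ≥0∞, ρ ≠ 0 ∧ ∀ y ∈ K, ρ ≤ density h x y := by
    rcases K.eq_empty_or_nonempty with rfl | hne
    · exact ⟨1, one_ne_zero, by simp⟩
    · obtain ⟨y, hy, hmin⟩ := hK.exists_isMinOn hne ((continuousOn_density h x).mono hKx)
      exact ⟨_, (density_pos h (hKx hy)).ne', hmin⟩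
  refine ⟨ρ⁻¹, ENNReal.inv_ne_top.2 hρ, fun F hF ↦ ?_⟩
  have hF1 := aemeasurable_comp_param h x hF
  have hm := (aemeasurable_param (n := n) x).mono_ac
    (withDensity_absolutelyContinuous (volume.restrict (chartDomain x)) (density h x))
  calc ∫⁻ y in K, F (param (n := n) x y) ≤ ∫⁻ y in K, ρ⁻¹ * (density h x y * F (param (n := n) x y)) := by
        refine setLIntegral_mono_ae' hK.measurableSet (ae_of_all _ fun y hy ↦ ?_)
        have hlt : ρ ≠ ⊤ := ((hρK y hy).trans_lt ENNReal.ofReal_lt_top).ne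
        calc F (param (n := n) x y) = ρ⁻¹ * (ρ * F (param (n := n) x y)) := by
              rw [← mul_assoc, ENNReal.inv_mul_cancel hρ hlt, one_mul]
          _ ≤ _ := by gcongr; exact hρK y hy
    _ = ρ⁻¹ * ∫⁻ y in K, density h x y * F (param (n := n) x y) :=
        lintegral_const_mul' _ _ (ENNReal.inv_ne_top.2 hρ)
    _ ≤ ρ⁻¹ * ∫⁻ y in chartDomain x, density h x y * F (param (n := n) x y) := by
        gcongr
    _ = ρ⁻¹ * ∫⁻ p, F p ∂chartVolume h x := by
        rw [chartVolume_eq, lintegral_map' _ hm,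
          lintegral_withDensity_eq_lintegral_mul₀ (aemeasurable_density h x) hF1]
        · rfl
        · exact hF.mono_measure (chartVolume_le_vol h x)
    _ ≤ _ := by
        gcongr
        exact chartVolume_le_vol h x

end Transfer

/-! ### Pointwise linear algebra of the metric. -/

section Fibre

variable {n : ℕ} {N : Type*} [TopologicalSpace N] [ChartedSpace (Eu n) N]
  [IsManifold 𝓘(ℝ, Eu n) ∞ N]

lemma inner_mul_inner_le (h : Metric n N) (p : N) (v w : TangentSpace 𝓘(ℝ, Eu n) p) :
    h.inner p v w ^ 2 ≤ h.inner p v v * h.inner p w w := by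
  rcases eq_or_ne w 0 with rfl | hw
  · simp
  · have hpos := h.pos p w hw
    -- Cauchy–Schwarz from the square of `⟨w,w⟩ v - ⟨v,w⟩ w`, divided by `⟨w,w⟩`.
    have h1 := inner_self_nonneg h p (h.inner p w w • v - h.inner p v w • w)
    simp only [map_sub, map_smul, sub_apply, smul_apply, smul_eq_mul, h.symm p w v] at h1
    have h2 : 0 ≤ h.inner p w w * (h.inner p v v * h.inner p w w - h.inner p v w ^ 2) := by
      nlinarith [h1]
    linarith [nonneg_of_mul_nonneg_right h2 hpos]

lemma abs_inner_le (h : Metric n N) (p : N) (v w : TangentSpace 𝓘(ℝ, Eu n) p) :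
    |h.inner p v w| ≤ √(h.inner p v v) * √(h.inner p w w) := by
  rw [← Real.sqrt_mul (inner_self_nonneg h p v)]
  exact Real.abs_le_sqrt (inner_mul_inner_le h p v w)

lemma two_mul_abs_inner_le (h : Metric n N) (p : N) (v w : TangentSpace 𝓘(ℝ, Eu n) p) :
    2 * |h.inner p v w| ≤ h.inner p v v + h.inner p w w := by
  have h1 := abs_inner_le h p v w
  nlinarith [sq_nonneg (√(h.inner p v v) - √(h.inner p w w)),
    Real.sq_sqrt (inner_self_nonneg h p v), Real.sq_sqrt (inner_self_nonneg h p w)]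

lemma inner_sub_self (h : Metric n N) (p : N) (v w : TangentSpace 𝓘(ℝ, Eu n) p) :
    h.inner p (v - w) (v - w) = h.inner p v v - 2 * h.inner p v w + h.inner p w w := by
  simp only [map_sub, sub_apply, h.symm p w v]
  ring

/-- Measurability of a field is imposed on its covariant components `h(X, ∂_v)`, so the inner
product has to be expressed through these, which brings in the inverse Gram matrix. -/
lemma inner_param_eq_sum (h : Metric n N) (X Y : Π p : N, TangentSpace 𝓘(ℝ, Eu n) p) {x : N}
    {y : Eu n} (hy : y ∈ chartDomain x) :
    h.inner (param x y) (X (param x y)) (Y (param x y)) =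
      ∑ i, ∑ j, chartComponent h X x (EuclideanSpace.single i 1) y * (gram h x y)⁻¹ i j *
        chartComponent h Y x (EuclideanSpace.single j 1) y := by
  have hG := gram_posDef h hy
  have hdet : IsUnit (gram h x y).det := (gram_det_pos h hy).ne'.isUnit
  have hsymm : (gram h x y).transpose = gram h x y := by
    simpa using hG.isHermitian.eq
  have hcomp : ∀ a : Eu n, ∀ i, h.inner (param x y) (coordVec x y a)
      (coordVec x y (EuclideanSpace.single i 1)) = Matrix.vecMul a.ofLp (gram h x y) i := by
    intro a i
    rw [inner_coordVec, Matrix.dotProduct_mulVec]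
    simp
  obtain ⟨a, ha⟩ := (coordVec_bijective hy).2 (X (param x y))
  obtain ⟨b, hb⟩ := (coordVec_bijective hy).2 (Y (param x y))
  simp only [chartComponent, ← ha, ← hb, hcomp, inner_coordVec]
  have h1 : ∑ i, ∑ j, Matrix.vecMul a.ofLp (gram h x y) i * (gram h x y)⁻¹ i j *
      Matrix.vecMul b.ofLp (gram h x y) j =
      Matrix.vecMul (Matrix.vecMul a.ofLp (gram h x y)) (gram h x y)⁻¹ ⬝ᵥ
        Matrix.vecMul b.ofLp (gram h x y) := by
    rw [Finset.sum_comm]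
    simp only [dotProduct, ← Finset.sum_mul]
    rfl
  rw [h1, Matrix.vecMul_vecMul, Matrix.mul_nonsing_inv _ hdet, Matrix.vecMul_one,
    ← Matrix.mulVec_transpose, hsymm]

end Fibre

/-! ### Measurable and square integrable vector fields. -/

section Fields

variable {n : ℕ} {N : Type*} [TopologicalSpace N] [ChartedSpace (Eu n) N]
  [IsManifold 𝓘(ℝ, Eu n) ∞ N] [MeasurableSpace N] [BorelSpace N]

lemma chartComponent_sub (h : Metric n N) (X Y : Π p : N, TangentSpace 𝓘(ℝ, Eu n) p) (x : N)
    (v y : Eu n) : chartComponent h (fun p ↦ X p - Y p) x v y =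
      chartComponent h X x v y - chartComponent h Y x v y := by
  simp [chartComponent]

lemma AEMeasurableField.sub {h : Metric n N} {X Y : Π p : N, TangentSpace 𝓘(ℝ, Eu n) p}
    (hX : AEMeasurableField h X) (hY : AEMeasurableField h Y) :
    AEMeasurableField h (fun p ↦ X p - Y p) := fun x v ↦
  ((hX x v).sub (hY x v)).congr (ae_of_all _ fun y ↦ (chartComponent_sub h X Y x v y).symm)

lemma abs_chartComponent_le (h : Metric n N) (X : Π p : N, TangentSpace 𝓘(ℝ, Eu n) p) (x : N)
    (v y : Eu n) : |chartComponent h X x v y| ≤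
      √(h.inner (param x y) (X (param x y)) (X (param x y))) *
        √(h.inner (param x y) (coordVec x y v) (coordVec x y v)) :=
  abs_inner_le h _ _ _

variable [T2Space N] [CompactSpace N]

lemma aemeasurable_inner {h : Metric n N} {X Y : Π p : N, TangentSpace 𝓘(ℝ, Eu n) p}
    (hX : AEMeasurableField h X) (hY : AEMeasurableField h Y) :
    AEMeasurable (fun p ↦ h.inner p (X p) (Y p)) (vol h) := by
  refine aemeasurable_of_comp_param h fun x ↦ ?_
  have h1 : AEMeasurable (fun y ↦
      ∑ i, ∑ j, chartComponent h X x (EuclideanSpace.single i 1) y * (gram h x y)⁻¹ i j *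
        chartComponent h Y x (EuclideanSpace.single j 1) y)
      (volume.restrict (chartDomain x)) := by
    refine Finset.aemeasurable_fun_sum _ fun i _ ↦ Finset.aemeasurable_fun_sum _ fun j _ ↦ ?_
    exact ((hX x _).mul ((continuousOn_gram_inv h x i j).aemeasurable
      (isOpen_chartDomain x).measurableSet)).mul (hY x _)
  refine h1.congr ?_
  filter_upwards [ae_restrict_mem (isOpen_chartDomain x).measurableSet] with y hy
  exact (inner_param_eq_sum h X Y hy).symm

lemma integrable_inner {h : Metric n N} {X Y : Π p : N, TangentSpace 𝓘(ℝ, Eu n) p}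
    (hX : AEMeasurableField h X) (hY : AEMeasurableField h Y)
    (hX2 : Integrable (fun p ↦ h.inner p (X p) (X p)) (vol h))
    (hY2 : Integrable (fun p ↦ h.inner p (Y p) (Y p)) (vol h)) :
    Integrable (fun p ↦ h.inner p (X p) (Y p)) (vol h) := by
  refine (hX2.add hY2).mono' (aemeasurable_inner hX hY).aestronglyMeasurable
    (ae_of_all _ fun p ↦ ?_)
  have h1 := two_mul_abs_inner_le h p (X p) (Y p)
  have h2 := abs_nonneg (h.inner p (X p) (Y p))
  simp only [Real.norm_eq_abs, Pi.add_apply]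
  linarith

lemma integrable_inner_sub_self {h : Metric n N} {X Y : Π p : N, TangentSpace 𝓘(ℝ, Eu n) p}
    (hX : AEMeasurableField h X) (hY : AEMeasurableField h Y)
    (hX2 : Integrable (fun p ↦ h.inner p (X p) (X p)) (vol h))
    (hY2 : Integrable (fun p ↦ h.inner p (Y p) (Y p)) (vol h)) :
    Integrable (fun p ↦ h.inner p (X p - Y p) (X p - Y p)) (vol h) := by
  simp only [inner_sub_self]
  exact (hX2.sub ((integrable_inner hX hY hX2 hY2).const_mul 2)).add hY2

end Fields

/-! ### Weak gradients: integrability of the pairings and stability under limits. -/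

section WeakGradient

variable {n : ℕ} {N : Type*} [TopologicalSpace N] [ChartedSpace (Eu n) N]
  [IsManifold 𝓘(ℝ, Eu n) ∞ N] [MeasurableSpace N] [BorelSpace N]

/-- Common source of the bounds for both sides of the weak gradient identity: a weight supported in
a compact part of the chart is bounded, and there Lebesgue measure is controlled by `vol h`, with
`c` independent of `F`. -/
lemma exists_lintegral_param_mul_le (h : Metric n N) (x : N) {K : Set (Eu n)} (hK : IsCompact K)
    (hKx : K ⊆ chartDomain x) {θ : Eu n → ℝ} (hθ : ContinuousOn θ K) (hθ0 : ∀ y ∉ K, θ y = 0) :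
    ∃ c : ℝ≥0∞, c ≠ ⊤ ∧ ∀ F : N → ℝ≥0∞, AEMeasurable F (vol h) →
      ∫⁻ y, F (param x y) * ‖θ y‖ₑ ≤ c * ∫⁻ p, F p ∂vol h := by
  obtain ⟨c, hc, hcF⟩ := exists_setLIntegral_param_le h x hK hKx
  obtain ⟨M, hM⟩ := hK.exists_bound_of_continuousOn hθ
  refine ⟨ENNReal.ofReal M * c, ENNReal.mul_ne_top ENNReal.ofReal_ne_top hc, fun F hF ↦ ?_⟩
  calc ∫⁻ y, F (param x y) * ‖θ y‖ₑ
      ≤ ∫⁻ y, K.indicator (fun y ↦ ENNReal.ofReal M * F (param x y)) y := by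
        refine lintegral_mono fun y ↦ ?_
        by_cases hy : y ∈ K
        · rw [Set.indicator_of_mem hy, mul_comm]
          gcongr
          rw [← ofReal_norm]
          exact ENNReal.ofReal_le_ofReal (hM y hy)
        · simp [hθ0 y hy]
    _ = ENNReal.ofReal M * ∫⁻ y in K, F (param x y) := by
        rw [lintegral_indicator hK.measurableSet, lintegral_const_mul' _ _ ENNReal.ofReal_ne_top]
    _ ≤ ENNReal.ofReal M * (c * ∫⁻ p, F p ∂vol h) := by gcongr; exact hcF F hF
    _ = _ := (mul_assoc _ _ _).symm

/-- Bound for the pairing of a function with a derivative of a test function. -/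
lemma exists_lintegral_mul_fderiv_le (h : Metric n N) (x : N) (v : Eu n) {ψ : Eu n → ℝ}
    (hψ : ContDiff ℝ ∞ ψ) (hc : HasCompactSupport ψ) (hs : tsupport ψ ⊆ chartDomain x) :
    ∃ c : ℝ≥0∞, c ≠ ⊤ ∧ ∀ f : N → ℝ, AEMeasurable f (vol h) →
      ∫⁻ y, ‖f (param x y) * fderiv ℝ ψ y v‖ₑ ≤ c * ∫⁻ p, ‖f p‖ₑ ∂vol h := by
  obtain ⟨c, hc1, hc2⟩ := exists_lintegral_param_mul_le h x hc hs
    (θ := fun y ↦ fderiv ℝ ψ y v)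
    ((hψ.continuous_fderiv (by simp)).clm_apply continuous_const).continuousOn
    (fun y hy ↦ by
      have : y ∉ Function.support (fderiv ℝ ψ) := fun hy' ↦ hy (support_fderiv_subset ℝ hy')
      rw [Function.notMem_support.1 this]; rfl)
  refine ⟨c, hc1, fun f hf ↦ ?_⟩
  simpa only [enorm_mul] using hc2 (fun p ↦ ‖f p‖ₑ) hf.enorm

/-- Bound for the pairing of a vector field with a test function. -/
lemma exists_lintegral_chartComponent_mul_le [T2Space N] [CompactSpace N] (h : Metric n N) (x : N)
    (v : Eu n) {ψ : Eu n → ℝ}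
    (hψ : ContDiff ℝ ∞ ψ) (hc : HasCompactSupport ψ) (hs : tsupport ψ ⊆ chartDomain x) :
    ∃ c : ℝ≥0∞, c ≠ ⊤ ∧ ∀ X : Π p : N, TangentSpace 𝓘(ℝ, Eu n) p, AEMeasurableField h X →
      ∫⁻ y, ‖chartComponent h X x v y * ψ y‖ₑ ≤
        c * ∫⁻ p, ENNReal.ofReal √(h.inner p (X p) (X p)) ∂vol h := by
  obtain ⟨c, hc1, hc2⟩ := exists_lintegral_param_mul_le h x hc hs
    -- By Cauchy–Schwarz a component is at most `|X| |∂_v|`, so the length of the coordinate vector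
    -- is absorbed into the weight.
    (θ := fun y ↦ √(h.inner (param x y) (coordVec x y v) (coordVec x y v)) * ψ y)
    (((continuousOn_inner_coordVec h x v v).mono hs).sqrt.mul hψ.continuous.continuousOn)
    (fun y hy ↦ by simp [image_eq_zero_of_notMem_tsupport hy])
  refine ⟨c, hc1, fun X hX ↦ le_trans (lintegral_mono fun y ↦ ?_)
    (hc2 (fun p ↦ ENNReal.ofReal √(h.inner p (X p) (X p)))
      (aemeasurable_inner hX hX).sqrt.ennreal_ofReal)⟩
  rw [enorm_mul, enorm_mul, ← mul_assoc]
  gcongr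
  rw [← ofReal_norm, ← ofReal_norm, ← ENNReal.ofReal_mul (Real.sqrt_nonneg _)]
  refine ENNReal.ofReal_le_ofReal ?_
  rw [Real.norm_eq_abs, Real.norm_of_nonneg (Real.sqrt_nonneg _)]
  exact abs_chartComponent_le h X x v y

lemma aestronglyMeasurable_mul_of_tsupport_subset {x : N} {u θ : Eu n → ℝ}
    (hu : AEMeasurable u (volume.restrict (chartDomain x))) (hθ : AEMeasurable θ)
    (h0 : ∀ y ∉ (chartDomain x : Set (Eu n)), θ y = 0) :
    AEStronglyMeasurable (fun y ↦ u y * θ y) volume := by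
  have h2 := (aemeasurable_indicator_iff (isOpen_chartDomain x).measurableSet).2
    (hu.mul hθ.restrict)
  refine h2.aestronglyMeasurable.congr (ae_of_all _ fun y ↦ ?_)
  by_cases hy : y ∈ (chartDomain x : Set (Eu n))
  · simp [Set.indicator_of_mem hy]
  · simp [Set.indicator_of_notMem hy, h0 y hy]

lemma fderiv_apply_eq_zero_of_notMem {x : N} (v : Eu n) {ψ : Eu n → ℝ}
    (hs : tsupport ψ ⊆ chartDomain x) : ∀ y ∉ (chartDomain x : Set (Eu n)),
      fderiv ℝ ψ y v = 0 := fun y hy ↦ by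
  have : y ∉ Function.support (fderiv ℝ ψ) := fun hy' ↦ hy (hs (support_fderiv_subset ℝ hy'))
  rw [Function.notMem_support.1 this]; rfl

lemma integrable_mul_fderiv {h : Metric n N} {f : N → ℝ} (hf : Integrable f (vol h)) (x : N)
    (v : Eu n) {ψ : Eu n → ℝ} (hψ : ContDiff ℝ ∞ ψ) (hc : HasCompactSupport ψ)
    (hs : tsupport ψ ⊆ chartDomain x) :
    Integrable (fun y ↦ f (param x y) * fderiv ℝ ψ y v) := by
  obtain ⟨c, hc1, hc2⟩ := exists_lintegral_mul_fderiv_le h x v hψ hc hs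
  refine ⟨aestronglyMeasurable_mul_of_tsupport_subset
    (aemeasurable_comp_param h x hf.aemeasurable)
    ((hψ.continuous_fderiv (by simp)).clm_apply continuous_const).aemeasurable
    (fderiv_apply_eq_zero_of_notMem v hs), ?_⟩
  exact (hc2 f hf.aemeasurable).trans_lt (ENNReal.mul_lt_top hc1.lt_top hf.2)

variable [T2Space N] [CompactSpace N]

lemma lintegral_sqrt_inner_lt_top {h : Metric n N} {X : Π p : N, TangentSpace 𝓘(ℝ, Eu n) p}
    (hX2 : Integrable (fun p ↦ h.inner p (X p) (X p)) (vol h)) :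
    ∫⁻ p, ENNReal.ofReal √(h.inner p (X p) (X p)) ∂vol h < ⊤ := by
  have h1 : Integrable (fun p ↦ 1 + h.inner p (X p) (X p)) (vol h) :=
    (integrable_const 1).add hX2
  refine lt_of_le_of_lt (lintegral_mono fun p ↦ ENNReal.ofReal_le_ofReal ?_)
    h1.lintegral_lt_top
  have := inner_self_nonneg h p (X p)
  rw [Real.sqrt_le_left (by linarith)]
  nlinarith

lemma integrable_chartComponent_mul {h : Metric n N} {X : Π p : N, TangentSpace 𝓘(ℝ, Eu n) p}
    (hX : AEMeasurableField h X) (hX2 : Integrable (fun p ↦ h.inner p (X p) (X p)) (vol h)) (x : N)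
    (v : Eu n) {ψ : Eu n → ℝ} (hψ : ContDiff ℝ ∞ ψ) (hc : HasCompactSupport ψ)
    (hs : tsupport ψ ⊆ chartDomain x) :
    Integrable (fun y ↦ chartComponent h X x v y * ψ y) := by
  obtain ⟨c, hc1, hc2⟩ := exists_lintegral_chartComponent_mul_le h x v hψ hc hs
  refine ⟨aestronglyMeasurable_mul_of_tsupport_subset (hX x v) hψ.continuous.aemeasurable
    fun y hy ↦ image_eq_zero_of_notMem_tsupport fun hy' ↦ hy (hs hy'), ?_⟩
  exact (hc2 X hX).trans_lt (ENNReal.mul_lt_top hc1.lt_top (lintegral_sqrt_inner_lt_top hX2))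

/-- The constant is included because the energy estimate tests with a difference shifted to be
nonnegative. -/
lemma isWeakGradient_sub_add_const {h : Metric n N} (u w : W12 h) (c : ℝ) :
    IsWeakGradient h (fun p ↦ u p - w p + c) (fun p ↦ u.grad p - w.grad p) := by
  intro x v ψ hψ hc hs
  have hu := u.memLp.integrable (by norm_num)
  have hw := w.memLp.integrable (by norm_num)
  have iu := integrable_mul_fderiv hu x v hψ hc hs
  have iw := integrable_mul_fderiv hw x v hψ hc hs
  have ic := integrable_mul_fderiv (h := h) (integrable_const c) x v hψ hc hs
  have ju := integrable_chartComponent_mul u.measurable_grad u.integrable_grad_sq x v hψ hc hs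
  have jw := integrable_chartComponent_mul w.measurable_grad w.integrable_grad_sq x v hψ hc hs
  -- Integration by parts against a constant: a derivative of a compactly supported function has
  -- integral zero.
  have h0 : ∫ y, c * fderiv ℝ ψ y v = 0 := by
    have := integral_mul_fderiv_eq_neg_fderiv_mul_of_integrable (μ := (volume : Measure (Eu n)))
      (f := fun _ : Eu n ↦ c) (g := ψ) (v := v) (by simp) ic
      ((hψ.continuous.integrable_of_hasCompactSupport hc).const_mul c)
      (fun y _ ↦ differentiableAt_const c)
      (fun y _ ↦ (hψ.differentiable (by simp)).differentiableAt)
    simpa using this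
  simp only [chartComponent_sub, sub_mul, add_mul]
  have hadd := integral_add (iu.sub iw) ic
  simp only [Pi.sub_apply] at hadd
  rw [hadd, integral_sub iu iw, integral_sub ju jw,
    u.isWeakGradient x v ψ hψ hc hs, w.isWeakGradient x v ψ hψ hc hs, h0]
  ring

/-- Weak gradients pass to `L¹` limits. -/
lemma isWeakGradient_of_tendsto {h : Metric n N} {f : ℕ → N → ℝ}
    {X : ℕ → Π p : N, TangentSpace 𝓘(ℝ, Eu n) p} {g : N → ℝ}
    {Y : Π p : N, TangentSpace 𝓘(ℝ, Eu n) p}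
    (hf : ∀ k, Integrable (f k) (vol h)) (hX : ∀ k, AEMeasurableField h (X k))
    (hX2 : ∀ k, Integrable (fun p ↦ h.inner p (X k p) (X k p)) (vol h))
    (hfX : ∀ k, IsWeakGradient h (f k) (X k))
    (hg : Integrable g (vol h)) (hY : AEMeasurableField h Y)
    (hfg : Tendsto (fun k ↦ ∫⁻ p, ‖f k p - g p‖ₑ ∂vol h) atTop (𝓝 0))
    (hXY : Tendsto (fun k ↦ ∫⁻ p,
      ENNReal.ofReal √(h.inner p (X k p - Y p) (X k p - Y p)) ∂vol h) atTop (𝓝 0)) :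
    IsWeakGradient h g Y := by
  intro x v ψ hψ hc hs
  have h1 : Tendsto (fun k ↦ ∫ y, f k (param x y) * fderiv ℝ ψ y v) atTop
      (𝓝 (∫ y, g (param x y) * fderiv ℝ ψ y v)) := by
    obtain ⟨c, hc1, hc2⟩ := exists_lintegral_mul_fderiv_le h x v hψ hc hs
    refine tendsto_integral_of_L1 _ (integrable_mul_fderiv hg x v hψ hc hs).1
      (Eventually.of_forall fun k ↦ integrable_mul_fderiv (hf k) x v hψ hc hs) ?_
    have h2 := ENNReal.Tendsto.const_mul hfg (Or.inr hc1)
    rw [mul_zero] at h2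
    refine tendsto_of_tendsto_of_tendsto_of_le_of_le tendsto_const_nhds h2 (fun _ ↦ zero_le)
      fun k ↦ ?_
    simpa only [sub_mul] using hc2 (fun p ↦ f k p - g p) ((hf k).sub hg).aemeasurable
  have h2 : Tendsto (fun k ↦ ∫ y, chartComponent h (X k) x v y * ψ y) atTop
      (𝓝 (∫ y, chartComponent h Y x v y * ψ y)) := by
    obtain ⟨c, hc1, hc2⟩ := exists_lintegral_chartComponent_mul_le h x v hψ hc hs
    refine tendsto_integral_of_L1 _
      (aestronglyMeasurable_mul_of_tsupport_subset (hY x v) hψ.continuous.aemeasurable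
        fun y hy ↦ image_eq_zero_of_notMem_tsupport fun hy' ↦ hy (hs hy'))
      (Eventually.of_forall fun k ↦
        integrable_chartComponent_mul (hX k) (hX2 k) x v hψ hc hs) ?_
    have h2 := ENNReal.Tendsto.const_mul hXY (Or.inr hc1)
    rw [mul_zero] at h2
    refine tendsto_of_tendsto_of_tendsto_of_le_of_le tendsto_const_nhds h2 (fun _ ↦ zero_le)
      fun k ↦ ?_
    simpa only [chartComponent_sub, sub_mul] using hc2 (fun p ↦ X k p - Y p) ((hX k).sub hY)
  refine tendsto_nhds_unique h1 ?_
  simp only [fun k ↦ hfX k x v ψ hψ hc hs]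
  exact h2.neg

end WeakGradient

/-! ### Completeness of the space of square integrable vector fields. -/

section Completeness

variable {n : ℕ} {N : Type*} [TopologicalSpace N] [ChartedSpace (Eu n) N]
  [IsManifold 𝓘(ℝ, Eu n) ∞ N]

/-- The unit ball of `h` at `p` is bounded. The constant may depend on `p`, since it serves only for
pointwise convergence in one fibre. -/
lemma exists_norm_sq_le_inner (h : Metric n N) (p : N) :
    ∃ c : ℝ, ∀ v : Eu n, ‖v‖ ^ 2 ≤ c * h.inner p v v := by
  have hb : Bornology.IsVonNBounded ℝ {v : Eu n | h.inner p v v < 1} := h.isVonNBounded p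
  rw [NormedSpace.isVonNBounded_iff, isBounded_iff_forall_norm_le] at hb
  obtain ⟨r, hr⟩ := hb
  refine ⟨2 * r ^ 2, fun v ↦ ?_⟩
  rcases eq_or_ne v 0 with rfl | hv
  · rw [norm_zero]
    have : h.inner p (0 : Eu n) (0 : Eu n) = 0 := map_zero (h.inner p (0 : Eu n))
    rw [this]; simp
  · have hq : 0 < h.inner p v v := h.pos p v hv
    set q := h.inner p v v with hqdef
    -- Rescales `v` to have squared `h`-length `1/2`, inside the open unit ball.
    set t := (√(2 * q))⁻¹ with ht
    have ht2 : t ^ 2 * (2 * q) = 1 := by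
      rw [ht, inv_pow, Real.sq_sqrt (by positivity), inv_mul_cancel₀ (by positivity)]
    have h1 : h.inner p (t • v : Eu n) (t • v : Eu n) = t ^ 2 * q := by
      let B : Eu n →L[ℝ] Eu n →L[ℝ] ℝ := h.inner p
      have e : B (t • v) (t • v) = t ^ 2 * B v v := by
        rw [map_smul, map_smul, smul_apply, smul_eq_mul, smul_eq_mul]
        ring
      exact e
    have h2 : ‖t • v‖ ≤ r := hr _ (by rw [Set.mem_ofPred_eq, h1]; linarith)
    rw [norm_smul] at h2
    have h3 : (‖t‖ * ‖v‖) ^ 2 ≤ r ^ 2 := by gcongr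
    rw [mul_pow, Real.norm_eq_abs, sq_abs] at h3
    calc ‖v‖ ^ 2 = (t ^ 2 * (2 * q)) * ‖v‖ ^ 2 := by rw [ht2, one_mul]
      _ = 2 * q * (t ^ 2 * ‖v‖ ^ 2) := by ring
      _ ≤ 2 * q * r ^ 2 := by gcongr
      _ = _ := by ring

lemma continuous_inner_self (h : Metric n N) (p : N) :
    Continuous (fun v : Eu n ↦ h.inner p v v) := by
  have h1 : Continuous (fun v : TangentSpace 𝓘(ℝ, Eu n) p ↦ h.inner p v v) :=
    let B : Eu n →L[ℝ] Eu n →L[ℝ] ℝ := h.inner p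
    B.continuous.clm_apply continuous_id
  exact h1

/-- A sequence of tangent vectors whose increments decay geometrically converges. -/
lemma exists_tendsto_of_inner_le (h : Metric n N) (p : N) {v : ℕ → Eu n} {S : ℝ}
    (hv : ∀ j, h.inner p (v (j + 1) - v j : Eu n) (v (j + 1) - v j : Eu n) ≤ S * (1 / 4) ^ j) :
    ∃ w, Tendsto v atTop (𝓝 w) := by
  obtain ⟨c, hc⟩ := exists_norm_sq_le_inner h p
  have hc' : ∀ v : Eu n, ‖v‖ ^ 2 ≤ |c| * h.inner p v v := fun v ↦ (hc v).trans
    (mul_le_mul_of_nonneg_right (le_abs_self c) (inner_self_nonneg h p v))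
  have hS : 0 ≤ S := by simpa using (inner_self_nonneg h p _).trans (hv 0)
  refine cauchySeq_tendsto_of_complete
    (cauchySeq_of_le_geometric (1 / 2) √(|c| * S) (by norm_num) fun j ↦ ?_)
  rw [dist_comm, dist_eq_norm]
  refine le_of_sq_le_sq ?_ (by positivity)
  rw [mul_pow, Real.sq_sqrt (by positivity), ← pow_mul, mul_comm j 2, pow_mul]
  calc _ ≤ |c| * (S * (1 / 4) ^ j) := (hc' _).trans (by gcongr; exact hv j)
    _ = _ := by rw [mul_assoc]; norm_num

variable [MeasurableSpace N] [BorelSpace N] [T2Space N] [CompactSpace N]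

/-- Square integrable vector fields form a complete space. -/
theorem exists_limit_field {h : Metric n N} {X : ℕ → Π p : N, TangentSpace 𝓘(ℝ, Eu n) p}
    (hX : ∀ k, AEMeasurableField h (X k))
    (hX2 : ∀ k, Integrable (fun p ↦ h.inner p (X k p) (X k p)) (vol h))
    (hcau : ∀ ε : ℝ≥0∞, 0 < ε → ∃ m, ∀ k l, m ≤ k → m ≤ l →
      ∫⁻ p, ENNReal.ofReal (h.inner p (X k p - X l p) (X k p - X l p)) ∂vol h ≤ ε) :
    ∃ Y : Π p : N, TangentSpace 𝓘(ℝ, Eu n) p, AEMeasurableField h Y ∧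
      Integrable (fun p ↦ h.inner p (Y p) (Y p)) (vol h) ∧
      Tendsto (fun k ↦ ∫⁻ p, ENNReal.ofReal (h.inner p (X k p - Y p) (X k p - Y p)) ∂vol h)
        atTop (𝓝 0) := by
  have hmeas : ∀ k l, AEMeasurable (fun p ↦
      ENNReal.ofReal (h.inner p (X k p - X l p) (X k p - X l p))) (vol h) := fun k l ↦
    (aemeasurable_inner ((hX k).sub (hX l)) ((hX k).sub (hX l))).ennreal_ofReal
  -- The rate `8⁻ʲ` leaves a summable `2⁻ʲ` after weighting by `4ʲ`; a finite weighted sum at `p`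
  -- then forces squared increments of order `4⁻ʲ`, hence convergence there.
  obtain ⟨φ, hφ, hφE⟩ := extraction_forall_of_eventually'
    (P := fun j m ↦ ∀ k l, m ≤ k → m ≤ l →
      ∫⁻ p, ENNReal.ofReal (h.inner p (X k p - X l p) (X k p - X l p)) ∂vol h ≤ (8⁻¹ : ℝ≥0∞) ^ j)
    (fun j ↦ by
      obtain ⟨m, hm⟩ := hcau ((8⁻¹ : ℝ≥0∞) ^ j) (ENNReal.pow_pos (by simp) j)
      exact ⟨m, fun m' hm' k l hk hl ↦ hm k l (hm'.trans hk) (hm'.trans hl)⟩)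
  have hsum : ∀ᵐ p ∂vol h, ∑' j, (4 : ℝ≥0∞) ^ j * ENNReal.ofReal
      (h.inner p (X (φ (j + 1)) p - X (φ j) p) (X (φ (j + 1)) p - X (φ j) p)) < ⊤ := by
    refine ae_lt_top' (AEMeasurable.tsum fun j ↦ (hmeas _ _).const_mul _) (ne_of_lt ?_)
    rw [lintegral_tsum fun j ↦ (hmeas _ _).const_mul _]
    calc _ ≤ ∑' j : ℕ, (2⁻¹ : ℝ≥0∞) ^ j := by
          refine ENNReal.tsum_le_tsum fun j ↦ ?_
          rw [lintegral_const_mul' _ _ (by finiteness)]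
          calc _ ≤ (4 : ℝ≥0∞) ^ j * 8⁻¹ ^ j := by
                gcongr
                exact hφE j _ _ (hφ.monotone (Nat.le_succ j)) le_rfl
            _ = _ := by
                rw [← mul_pow]
                congr 1
                rw [show (8 : ℝ≥0∞) = 4 * 2 by norm_num,
                  ENNReal.mul_inv (by simp) (by simp), ← mul_assoc,
                  ENNReal.mul_inv_cancel (by simp) (by simp), one_mul]
      _ < ⊤ := by
          rw [ENNReal.tsum_geometric]
          simp
  -- The limit is taken in the fixed model space; its arbitrary value where there is no convergence
  -- concerns only a null set.
  set Y : Π p : N, TangentSpace 𝓘(ℝ, Eu n) p :=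
    fun p ↦ limUnder atTop (fun j ↦ (X (φ j) p : Eu n)) with hY
  have hlim : ∀ᵐ p ∂vol h, Tendsto (fun j ↦ (X (φ j) p : Eu n)) atTop (𝓝 (Y p : Eu n)) := by
    filter_upwards [hsum] with p hp
    refine tendsto_nhds_limUnder (exists_tendsto_of_inner_le h p (S := (∑' j, (4 : ℝ≥0∞) ^ j *
      ENNReal.ofReal (h.inner p (X (φ (j + 1)) p - X (φ j) p)
        (X (φ (j + 1)) p - X (φ j) p))).toReal) fun j ↦ ?_)
    have h1 := ENNReal.toReal_mono hp.ne (ENNReal.le_tsum (f := fun j ↦ (4 : ℝ≥0∞) ^ j *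
      ENNReal.ofReal (h.inner p (X (φ (j + 1)) p - X (φ j) p)
        (X (φ (j + 1)) p - X (φ j) p))) j)
    rw [ENNReal.toReal_mul, ENNReal.toReal_pow, ENNReal.toReal_ofNat,
      ENNReal.toReal_ofReal (inner_self_nonneg h p _)] at h1
    rw [one_div, inv_pow, ← div_eq_mul_inv, le_div_iff₀ (by positivity), mul_comm]
    exact h1
  have hlim2 : ∀ k, ∀ᵐ p ∂vol h, Tendsto (fun j ↦ ENNReal.ofReal
      (h.inner p (X k p - X (φ j) p) (X k p - X (φ j) p))) atTop
      (𝓝 (ENNReal.ofReal (h.inner p (X k p - Y p) (X k p - Y p)))) := by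
    intro k
    filter_upwards [hlim] with p hp
    refine ENNReal.tendsto_ofReal ?_
    exact ((continuous_inner_self h p).tendsto _).comp (hp.const_sub (X k p : Eu n))
  have hYm : AEMeasurableField h Y := by
    intro x v
    refine aemeasurable_of_tendsto_metrizable_ae atTop (fun j ↦ hX (φ j) x v) ?_
    filter_upwards [ae_param_of_ae_vol h x hlim] with y hy
    have hc : Continuous (fun w : Eu n ↦ h.inner (param x y) w (coordVec x y v)) :=
      let B : Eu n →L[ℝ] Eu n →L[ℝ] ℝ := h.inner (param x y)
      B.continuous.clm_apply continuous_const
    exact (hc.tendsto _).comp hy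
  -- Fatou along the subsequence turns the Cauchy estimate into an estimate for the whole sequence
  -- against `Y`.
  have hfatou : ∀ ε : ℝ≥0∞, 0 < ε → ∃ m, ∀ k, m ≤ k →
      ∫⁻ p, ENNReal.ofReal (h.inner p (X k p - Y p) (X k p - Y p)) ∂vol h ≤ ε := by
    intro ε hε
    obtain ⟨m, hm⟩ := hcau ε hε
    refine ⟨m, fun k hk ↦ ?_⟩
    calc _ = ∫⁻ p, liminf (fun j ↦ ENNReal.ofReal
          (h.inner p (X k p - X (φ j) p) (X k p - X (φ j) p))) atTop ∂vol h := by
          refine lintegral_congr_ae ?_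
          filter_upwards [hlim2 k] with p hp using hp.liminf_eq.symm
      _ ≤ liminf (fun j ↦ ∫⁻ p, ENNReal.ofReal
          (h.inner p (X k p - X (φ j) p) (X k p - X (φ j) p)) ∂vol h) atTop :=
          lintegral_liminf_le' fun j ↦ hmeas _ _
      _ ≤ liminf (fun _ : ℕ ↦ ε) atTop := by
          refine liminf_le_liminf ?_
          filter_upwards [eventually_ge_atTop m] with j hj
          exact hm _ _ hk (hj.trans hφ.le_apply)
      _ = ε := liminf_const ε
  refine ⟨Y, hYm, ?_, ?_⟩
  · obtain ⟨m, hm⟩ := hfatou 1 one_pos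
    have hd : Integrable (fun p ↦ h.inner p (X m p - Y p) (X m p - Y p)) (vol h) := by
      refine ⟨(aemeasurable_inner ((hX m).sub hYm) ((hX m).sub hYm)).aestronglyMeasurable, ?_⟩
      rw [hasFiniteIntegral_iff_ofReal (ae_of_all _ fun p ↦ inner_self_nonneg h p _)]
      exact (hm m le_rfl).trans_lt ENNReal.one_lt_top
    -- `Y = X m - (X m - Y)` is a difference of square integrable fields.
    simpa only [sub_sub_cancel] using
      integrable_inner_sub_self (hX m) ((hX m).sub hYm) (hX2 m) hd
  · refine ENNReal.tendsto_nhds_zero.2 fun ε hε ↦ ?_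
    obtain ⟨m, hm⟩ := hfatou ε hε
    exact eventually_atTop.2 ⟨m, hm⟩

end Completeness

/-! ### The energy estimate from one-sided Laplacian bounds. -/

section Energy

variable {n : ℕ} {N : Type*} [TopologicalSpace N] [ChartedSpace (Eu n) N]
  [IsManifold 𝓘(ℝ, Eu n) ∞ N] [MeasurableSpace N] [BorelSpace N] [T2Space N] [CompactSpace N]

/-- The Sobolev function `u - w + c`, with weak gradient `∇u - ∇w`. -/
def W12.subAddConst {h : Metric n N} (u w : W12 h) (c : ℝ) : W12 h where
  toFun := fun p ↦ u p - w p + c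
  grad := fun p ↦ u.grad p - w.grad p
  memLp := (u.memLp.sub w.memLp).add (memLp_const c)
  measurable_grad := u.measurable_grad.sub w.measurable_grad
  integrable_grad_sq := integrable_inner_sub_self u.measurable_grad w.measurable_grad
    u.integrable_grad_sq w.integrable_grad_sq
  isWeakGradient := isWeakGradient_sub_add_const u w c

lemma W12.integrable_inner_grad {h : Metric n N} (u w : W12 h) :
    Integrable (fun p ↦ h.inner p (u.grad p) (w.grad p)) (vol h) :=
  integrable_inner u.measurable_grad w.measurable_grad u.integrable_grad_sq w.integrable_grad_sq

lemma W12.dirichlet_subAddConst_add {h : Metric n N} (u w : W12 h) (c : ℝ) :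
    u.dirichlet (u.subAddConst w c) + w.dirichlet (w.subAddConst u c) =
      ∫ p, h.inner p (u.grad p - w.grad p) (u.grad p - w.grad p) ∂vol h := by
  unfold W12.dirichlet
  rw [← integral_add (integrable_inner_grad _ _) (integrable_inner_grad _ _)]
  refine integral_congr_ae (ae_of_all _ fun p ↦ ?_)
  simp only [W12.subAddConst, map_sub, sub_apply]
  ring

lemma W12.dirichlet_subAddConst_add' {h : Metric n N} (u w : W12 h) (c : ℝ) :
    u.dirichlet (w.subAddConst u c) + w.dirichlet (u.subAddConst w c) =
      -∫ p, h.inner p (u.grad p - w.grad p) (u.grad p - w.grad p) ∂vol h := by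
  unfold W12.dirichlet
  rw [← integral_add (integrable_inner_grad _ _) (integrable_inner_grad _ _), ← integral_neg]
  refine integral_congr_ae (ae_of_all _ fun p ↦ ?_)
  simp only [W12.subAddConst, map_sub, sub_apply]
  ring

lemma W12.integral_subAddConst_add {h : Metric n N} (u w : W12 h) (c : ℝ) :
    ∫ p, u.subAddConst w c p ∂vol h + ∫ p, w.subAddConst u c p ∂vol h =
      2 * c * (vol h).real Set.univ := by
  rw [← integral_add ((u.subAddConst w c).memLp.integrable (by norm_num))
    ((w.subAddConst u c).memLp.integrable (by norm_num))]
  have : ∀ p, u.subAddConst w c p + w.subAddConst u c p = 2 * c := fun p ↦ by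
    simp only [W12.subAddConst]; ring
  simp only [this, integral_const, smul_eq_mul, mul_comm]

/-- If `u` and `w` are `ε`-close and their Laplacians are bounded from the same side by `C`, their
gradients are close in `L²`. -/
lemma W12.integral_inner_sub_le {h : Metric n N} {u w : W12 h} {C ε : ℝ}
    (hε : ∀ᵐ p ∂vol h, |u p - w p| ≤ ε)
    (hlap : (u.LaplacianLE C ∧ w.LaplacianLE C) ∨ (u.LaplacianGE (-C) ∧ w.LaplacianGE (-C))) :
    ∫ p, h.inner p (u.grad p - w.grad p) (u.grad p - w.grad p) ∂vol h ≤
      C * (2 * ε * (vol h).real Set.univ) := by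
  have h1 : ∀ᵐ p ∂vol h, 0 ≤ u.subAddConst w ε p := by
    filter_upwards [hε] with p hp
    simp only [W12.subAddConst]
    linarith [neg_le_of_abs_le hp]
  have h2 : ∀ᵐ p ∂vol h, 0 ≤ w.subAddConst u ε p := by
    filter_upwards [hε] with p hp
    simp only [W12.subAddConst]
    linarith [le_of_abs_le hp]
  rw [← W12.integral_subAddConst_add u w ε]
  -- For upper bounds each function is tested with the other minus itself, so the pairings add up to
  -- minus the energy; for lower bounds the roles are exchanged.
  rcases hlap with ⟨hu, hw⟩ | ⟨hu, hw⟩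
  · have e1 := hu _ h2
    have e2 := hw _ h1
    have e3 := W12.dirichlet_subAddConst_add' u w ε
    linarith
  · have e1 := hu _ h1
    have e2 := hw _ h2
    have e3 := W12.dirichlet_subAddConst_add u w ε
    linarith

end Energy

/-! ### Limits in `L²` and in the Sobolev space, and convergence of the energy densities. -/

section Limits

lemma lintegral_mul_le_sqrt {α : Type*} [MeasurableSpace α] {μ : Measure α} {F G : α → ℝ≥0∞}
    (hF : AEMeasurable F μ) (hG : AEMeasurable G μ) :
    ∫⁻ a, F a * G a ∂μ ≤
      (∫⁻ a, F a ^ 2 ∂μ) ^ (1 / 2 : ℝ) * (∫⁻ a, G a ^ 2 ∂μ) ^ (1 / 2 : ℝ) := by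
  have := ENNReal.lintegral_mul_le_Lp_mul_Lq μ Real.HolderConjugate.two_two hF hG
  simpa using this

lemma tendsto_lintegral_mul_of_sq {α : Type*} [MeasurableSpace α] {μ : Measure α}
    {F : ℕ → α → ℝ≥0∞} {G : α → ℝ≥0∞} (hF : ∀ k, AEMeasurable (F k) μ) (hG : AEMeasurable G μ)
    (hF0 : Tendsto (fun k ↦ ∫⁻ a, F k a ^ 2 ∂μ) atTop (𝓝 0)) (hG2 : ∫⁻ a, G a ^ 2 ∂μ ≠ ⊤) :
    Tendsto (fun k ↦ ∫⁻ a, F k a * G a ∂μ) atTop (𝓝 0) := by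
  have h1 : Tendsto (fun k ↦ (∫⁻ a, F k a ^ 2 ∂μ) ^ (1 / 2 : ℝ) *
      (∫⁻ a, G a ^ 2 ∂μ) ^ (1 / 2 : ℝ)) atTop (𝓝 0) := by
    have h2 := (ENNReal.continuous_rpow_const (y := 1 / 2)).tendsto 0 |>.comp hF0
    rw [ENNReal.zero_rpow_of_pos (by norm_num)] at h2
    have h3 := ENNReal.Tendsto.mul_const (b := (∫⁻ a, G a ^ 2 ∂μ) ^ (1 / 2 : ℝ)) h2
      (Or.inr (ENNReal.rpow_ne_top_of_nonneg (by norm_num) hG2))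
    simpa using h3
  exact tendsto_of_tendsto_of_tendsto_of_le_of_le tendsto_const_nhds h1 (fun _ ↦ zero_le)
    fun k ↦ lintegral_mul_le_sqrt (hF k) hG

lemma ofReal_sqrt_sq {q : ℝ} (hq : 0 ≤ q) : ENNReal.ofReal √q ^ 2 = ENNReal.ofReal q := by
  rw [← ENNReal.ofReal_pow (Real.sqrt_nonneg _), Real.sq_sqrt hq]

lemma enorm_sq_eq_ofReal (a : ℝ) : ‖a‖ₑ ^ 2 = ENNReal.ofReal (a ^ 2) := by
  rw [← ofReal_norm, ← ENNReal.ofReal_pow (norm_nonneg _), Real.norm_eq_abs, sq_abs]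

lemma lintegral_ofReal_sq {α : Type*} [MeasurableSpace α] {μ : Measure α} (u : α → ℝ) :
    ∫⁻ a, ENNReal.ofReal (u a ^ 2) ∂μ = eLpNorm u 2 μ ^ 2 := by
  have := eLpNorm_nnreal_pow_eq_lintegral (f := u) (μ := μ) (p := 2) (by norm_num)
  simp only [← enorm_sq_eq_ofReal]
  simpa using this.symm

/-- A sequence of square integrable functions on a finite measure space that is Cauchy in `L^∞`
converges in `L²`. -/
lemma exists_memLp_two_limit {α : Type*} [MeasurableSpace α] {μ : Measure α} [IsFiniteMeasure μ]
    {f : ℕ → α → ℝ} (hf : ∀ k, MemLp (f k) 2 μ)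
    (hcauchy : Tendsto (fun m : ℕ × ℕ ↦ eLpNorm (fun p ↦ f m.1 p - f m.2 p) ⊤ μ)
      (atTop ×ˢ atTop) (𝓝 0)) :
    ∃ g : α → ℝ, MemLp g 2 μ ∧
      Tendsto (fun k ↦ ∫⁻ a, ENNReal.ofReal ((f k a - g a) ^ 2) ∂μ) atTop (𝓝 0) := by
  have : Fact ((1 : ℝ≥0∞) ≤ 2) := ⟨by norm_num⟩
  -- Hölder on a finite measure space: the exponent is `1/2 - 1/∞`.
  have hle : ∀ m : ℕ × ℕ, eLpNorm (f m.1 - f m.2) 2 μ ≤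
      eLpNorm (fun p ↦ f m.1 p - f m.2 p) ⊤ μ * μ Set.univ ^ (1 / 2 : ℝ) := fun m ↦ by
    have := eLpNorm_le_eLpNorm_mul_rpow_measure_univ (p := 2) (q := ⊤) (μ := μ) le_top
      ((hf m.1).sub (hf m.2)).1
    simp only [ENNReal.toReal_ofNat, ENNReal.toReal_top, div_zero, sub_zero] at this
    exact this
  have h0 : Tendsto (fun m : ℕ × ℕ ↦ eLpNorm (f m.1 - f m.2) 2 μ) atTop (𝓝 0) := by
    rw [prod_atTop_atTop_eq] at hcauchy
    have h1 := ENNReal.Tendsto.mul_const (b := μ Set.univ ^ (1 / 2 : ℝ)) hcauchy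
      (Or.inr (ENNReal.rpow_ne_top_of_nonneg (by norm_num) (measure_ne_top _ _)))
    rw [zero_mul] at h1
    exact tendsto_of_tendsto_of_tendsto_of_le_of_le tendsto_const_nhds h1 (fun _ ↦ zero_le) hle
  have hc : CauchySeq (fun k ↦ (hf k).toLp (f k)) := by
    rw [Lp.cauchySeq_Lp_iff_cauchySeq_eLpNorm]
    refine h0.congr fun m ↦ eLpNorm_congr_ae ?_
    exact ((hf m.1).coeFn_toLp.sub (hf m.2).coeFn_toLp).symm
  obtain ⟨g, hg⟩ := cauchySeq_tendsto_of_complete hc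
  rw [Lp.tendsto_Lp_iff_tendsto_eLpNorm'] at hg
  refine ⟨g, Lp.memLp g, ?_⟩
  simp only [lintegral_ofReal_sq]
  have h2 : Tendsto (fun k ↦ eLpNorm (fun a ↦ f k a - g a) 2 μ) atTop (𝓝 0) :=
    hg.congr fun k ↦ eLpNorm_congr_ae ((hf k).coeFn_toLp.sub (ae_eq_refl _))
  have h3 := ((ENNReal.continuous_pow 2).tendsto 0).comp h2
  rw [zero_pow two_ne_zero] at h3
  exact h3

variable {n : ℕ} {N : Type*} [TopologicalSpace N] [ChartedSpace (Eu n) N]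
  [IsManifold 𝓘(ℝ, Eu n) ∞ N] [MeasurableSpace N] [BorelSpace N] [T2Space N] [CompactSpace N]

lemma W12.lintegral_ofReal_inner_grad_lt_top {h : Metric n N} (u : W12 h) :
    ∫⁻ p, ENNReal.ofReal (h.inner p (u.grad p) (u.grad p)) ∂vol h < ⊤ :=
  u.integrable_grad_sq.lintegral_lt_top

/-- Convergence of the gradients in `L²` implies convergence of their squares in the weak-`*`
sense. -/
lemma W12.tendsto_integral_gradSq_mul {h : Metric n N} {f : ℕ → W12 h} {g : W12 h}
    (hfg : Tendsto (fun k ↦ ∫⁻ p, ENNReal.ofReal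
      (h.inner p ((f k).grad p - g.grad p) ((f k).grad p - g.grad p)) ∂vol h) atTop (𝓝 0))
    {η : N → ℝ} (hη : MemLp η ⊤ (vol h)) :
    Tendsto (fun k ↦ ∫ p, (f k).gradSq p * η p ∂vol h) atTop
      (𝓝 (∫ p, g.gradSq p * η p ∂vol h)) := by
  have hint : ∀ u : W12 h, Integrable (fun p ↦ u.gradSq p * η p) (vol h) := fun u ↦
    u.integrable_grad_sq.mul_of_top_left hη
  refine tendsto_integral_of_L1 _ (hint g).1 (Eventually.of_forall fun k ↦ hint (f k)) ?_
  set D : ℕ → N → ℝ≥0∞ := fun k p ↦ ENNReal.ofReal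
    √(h.inner p ((f k).grad p - g.grad p) ((f k).grad p - g.grad p)) with hD
  set G : N → ℝ≥0∞ := fun p ↦ ENNReal.ofReal √(h.inner p (g.grad p) (g.grad p)) with hG
  have hsub : ∀ k, AEMeasurableField h (fun p ↦ (f k).grad p - g.grad p) := fun k ↦
    (f k).measurable_grad.sub g.measurable_grad
  have hDm : ∀ k, AEMeasurable (D k) (vol h) := fun k ↦
    (aemeasurable_inner (hsub k) (hsub k)).sqrt.ennreal_ofReal
  have hGm : AEMeasurable G (vol h) :=
    (aemeasurable_inner g.measurable_grad g.measurable_grad).sqrt.ennreal_ofReal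
  have hD2 : ∀ k p, D k p ^ 2 = ENNReal.ofReal
      (h.inner p ((f k).grad p - g.grad p) ((f k).grad p - g.grad p)) := fun k p ↦
    ofReal_sqrt_sq (inner_self_nonneg h p _)
  have hDlim : Tendsto (fun k ↦ ∫⁻ p, D k p ^ 2 ∂vol h) atTop (𝓝 0) := by
    simpa only [hD2] using hfg
  have hDG : Tendsto (fun k ↦ ∫⁻ p, D k p * G p ∂vol h) atTop (𝓝 0) := by
    refine tendsto_lintegral_mul_of_sq hDm hGm hDlim ?_
    simp only [hG, ofReal_sqrt_sq (inner_self_nonneg h _ _)]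
    exact g.lintegral_ofReal_inner_grad_lt_top.ne
  have hpt : ∀ k p, ENNReal.ofReal |(f k).gradSq p - g.gradSq p| ≤
      D k p ^ 2 + 2 * (D k p * G p) := by
    intro k p
    have h1 := abs_inner_le h p ((f k).grad p - g.grad p) (g.grad p)
    have h2 := inner_self_nonneg h p ((f k).grad p - g.grad p)
    have h3 : (f k).gradSq p - g.gradSq p =
        h.inner p ((f k).grad p - g.grad p) ((f k).grad p - g.grad p) +
          2 * h.inner p ((f k).grad p - g.grad p) (g.grad p) := by
      simp only [W12.gradSq, map_sub, sub_apply, h.symm p (g.grad p) ((f k).grad p)]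
      ring
    have htwo : ∀ z : ℝ, (2 : ℝ≥0∞) * ENNReal.ofReal z = ENNReal.ofReal (2 * z) := fun z ↦ by
      rw [ENNReal.ofReal_mul zero_le_two, ENNReal.ofReal_ofNat]
    rw [hD2, hD, hG, ← ENNReal.ofReal_mul (Real.sqrt_nonneg _),
      htwo,
      ← ENNReal.ofReal_add h2 (by positivity), h3]
    refine ENNReal.ofReal_le_ofReal ((abs_add_le _ _).trans ?_)
    rw [abs_of_nonneg h2, abs_mul, abs_two]
    gcongr
  have hlim : Tendsto (fun k ↦ eLpNorm η ⊤ (vol h) *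
      (∫⁻ p, D k p ^ 2 ∂vol h + 2 * ∫⁻ p, D k p * G p ∂vol h)) atTop (𝓝 0) := by
    have h1 := ENNReal.Tendsto.const_mul (a := eLpNorm η ⊤ (vol h))
      (hDlim.add (ENNReal.Tendsto.const_mul (a := 2) hDG (Or.inr (by simp)))) (Or.inr hη.2.ne)
    simpa using h1
  refine tendsto_of_tendsto_of_tendsto_of_le_of_le tendsto_const_nhds hlim (fun _ ↦ zero_le)
    fun k ↦ ?_
  calc ∫⁻ p, ‖(f k).gradSq p * η p - g.gradSq p * η p‖ₑ ∂vol h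
      ≤ ∫⁻ p, eLpNorm η ⊤ (vol h) * (D k p ^ 2 + 2 * (D k p * G p)) ∂vol h := by
        refine lintegral_mono_ae ?_
        rw [eLpNorm_exponent_top]
        filter_upwards [ae_le_eLpNormEssSup (f := η) (μ := vol h)] with p hp
        rw [← sub_mul, enorm_mul, mul_comm]
        gcongr
        rw [← ofReal_norm]
        exact hpt k p
    _ = _ := by
        rw [lintegral_const_mul' _ _ hη.2.ne, lintegral_add_left' ((hDm k).pow_const 2),
          lintegral_const_mul' _ _ (by simp)]

/-- The limit in `W^{1,2}` of a sequence that is Cauchy in `L^∞` and whose gradients are Cauchy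
in `L²`. -/
lemma W12.exists_limit {h : Metric n N} {f : ℕ → W12 h}
    (hcauchy : Tendsto
      (fun m : ℕ × ℕ ↦ eLpNorm (fun p ↦ f m.1 p - f m.2 p) ⊤ (vol h)) (atTop ×ˢ atTop) (𝓝 0))
    (hgrad : ∀ ε : ℝ≥0∞, 0 < ε → ∃ m, ∀ k l, m ≤ k → m ≤ l → ∫⁻ p, ENNReal.ofReal
      (h.inner p ((f k).grad p - (f l).grad p) ((f k).grad p - (f l).grad p)) ∂vol h ≤ ε) :
    ∃ g : W12 h, Tendsto (fun k ↦ ∫⁻ p, ENNReal.ofReal ((f k p - g p) ^ 2) ∂vol h) atTop (𝓝 0) ∧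
      Tendsto (fun k ↦ ∫⁻ p, ENNReal.ofReal
        (h.inner p ((f k).grad p - g.grad p) ((f k).grad p - g.grad p)) ∂vol h)
        atTop (𝓝 0) := by
  obtain ⟨g, hg, hfg⟩ := exists_memLp_two_limit (fun k ↦ (f k).memLp) hcauchy
  obtain ⟨Y, hY, hY2, hXY⟩ := exists_limit_field (fun k ↦ (f k).measurable_grad)
    (fun k ↦ (f k).integrable_grad_sq) hgrad
  -- Pairing with the constant `1`, square integrable as the volume is finite, converts `L²`
  -- convergence into the `L¹` convergence that weak gradients require.
  have hone : ∫⁻ _ : N, (1 : ℝ≥0∞) ^ 2 ∂vol h ≠ ⊤ := by simp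
  refine ⟨⟨g, Y, hg, hY, hY2, ?_⟩, hfg, hXY⟩
  refine isWeakGradient_of_tendsto (fun k ↦ (f k).memLp.integrable (by norm_num))
    (fun k ↦ (f k).measurable_grad) (fun k ↦ (f k).integrable_grad_sq)
    (fun k ↦ (f k).isWeakGradient) (hg.integrable (by norm_num)) hY ?_ ?_
  · have := tendsto_lintegral_mul_of_sq (F := fun k p ↦ ‖f k p - g p‖ₑ) (G := fun _ ↦ 1)
      (fun k ↦ ((f k).memLp.sub hg).1.aemeasurable.enorm) aemeasurable_const
      (by simpa only [enorm_sq_eq_ofReal] using hfg) hone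
    simpa using this
  · have := tendsto_lintegral_mul_of_sq (F := fun k p ↦ ENNReal.ofReal
        √(h.inner p ((f k).grad p - Y p) ((f k).grad p - Y p))) (G := fun _ ↦ 1)
      (fun k ↦ (aemeasurable_inner ((f k).measurable_grad.sub hY)
        ((f k).measurable_grad.sub hY)).sqrt.ennreal_ofReal) aemeasurable_const
      (by simpa only [ofReal_sqrt_sq (inner_self_nonneg h _ _)] using hXY) hone
    simpa using this

/-- One-sided Laplacian bounds and the Cauchy property in `L^∞` make the gradients Cauchy
in `L²`. -/
lemma W12.exists_lintegral_grad_sub_le {h : Metric n N} {f : ℕ → W12 h}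
    (hcauchy : Tendsto
      (fun m : ℕ × ℕ ↦ eLpNorm (fun p ↦ f m.1 p - f m.2 p) ⊤ (vol h)) (atTop ×ˢ atTop) (𝓝 0))
    {C : ℝ} (hC : 0 < C) (hlap : (∀ k, (f k).LaplacianLE C) ∨ (∀ k, (f k).LaplacianGE (-C)))
    (ε : ℝ≥0∞) (hε : 0 < ε) : ∃ m, ∀ k l, m ≤ k → m ≤ l → ∫⁻ p, ENNReal.ofReal
      (h.inner p ((f k).grad p - (f l).grad p) ((f k).grad p - (f l).grad p)) ∂vol h ≤ ε := by
  obtain ⟨δ, hδ, hδε⟩ : ∃ δ : ℝ, 0 < δ ∧ ENNReal.ofReal δ ≤ ε := by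
    obtain ⟨r, hr0, hr⟩ := ENNReal.lt_iff_exists_nnreal_btwn.1 hε
    exact ⟨r, by simpa using hr0, by simpa using hr.le⟩
  set V := (vol h).real Set.univ
  have hV : 0 ≤ V := measureReal_nonneg
  -- Chosen so that `C · 2t · (V + 1) = δ`; the `+ 1` keeps the denominator positive even when the
  -- volume vanishes.
  set t := δ / (2 * C * (V + 1)) with ht
  have htpos : 0 < t := by positivity
  rw [prod_atTop_atTop_eq] at hcauchy
  obtain ⟨⟨m, m'⟩, hm⟩ := eventually_atTop.1
    (ENNReal.tendsto_nhds_zero.1 hcauchy (ENNReal.ofReal t) (by simpa using htpos))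
  refine ⟨max m m', fun k l hk hl ↦ le_trans ?_ hδε⟩
  have hkl := hm (k, l) ⟨(le_max_left _ _).trans hk, (le_max_right _ _).trans hl⟩
  rw [eLpNorm_exponent_top] at hkl
  have hae : ∀ᵐ p ∂vol h, |f k p - f l p| ≤ t := by
    filter_upwards [ae_le_eLpNormEssSup (f := fun p ↦ f k p - f l p) (μ := vol h)] with p hp
    have := hp.trans hkl
    rwa [← ofReal_norm, ENNReal.ofReal_le_ofReal_iff htpos.le] at this
  have hle := W12.integral_inner_sub_le (u := f k) (w := f l) (C := C) hae
    (hlap.imp (fun H ↦ ⟨H k, H l⟩) fun H ↦ ⟨H k, H l⟩)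
  rw [← ofReal_integral_eq_lintegral_ofReal (integrable_inner_sub_self (f k).measurable_grad
    (f l).measurable_grad (f k).integrable_grad_sq (f l).integrable_grad_sq)
    (ae_of_all _ fun p ↦ inner_self_nonneg h p _)]
  refine ENNReal.ofReal_le_ofReal (hle.trans ?_)
  calc C * (2 * t * V) ≤ C * (2 * t * (V + 1)) := by gcongr; linarith
    _ = δ := by rw [ht]; field_simp

end Limits

end RiemSobolev

end

theorem lemma2p2 {n : ℕ} {N : Type*} [TopologicalSpace N] [T2Space N] [CompactSpace N]
    [ChartedSpace (RiemSobolev.Eu n) N] [IsManifold 𝓘(ℝ, RiemSobolev.Eu n) ∞ N]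
    [MeasurableSpace N] [BorelSpace N] (h : RiemSobolev.Metric n N)
    (f : ℕ → RiemSobolev.W12 h)
    (hbdd : ∃ B : ℝ≥0, ∀ k, (f k).norm ≤ B)
    (hmem : ∀ k k', MemLp (fun p ↦ f k p - f k' p) ∞ (RiemSobolev.vol h))
    (hcauchy : Tendsto
      (fun m : ℕ × ℕ ↦ eLpNorm (fun p ↦ f m.1 p - f m.2 p) ∞ (RiemSobolev.vol h))
      (atTop ×ˢ atTop) (𝓝 0))
    (C : ℝ) (hC : 0 < C)
    (hlap : (∀ k, (f k).LaplacianLE C) ∨ (∀ k, (f k).LaplacianGE (-C))) :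
    ∃ g : RiemSobolev.W12 h,
      Tendsto (fun k ↦ (f k).dist g) atTop (𝓝 0) ∧
      ∀ η : N → ℝ, MemLp η ∞ (RiemSobolev.vol h) →
        Tendsto (fun k ↦ ∫ p, (f k).gradSq p * η p ∂(RiemSobolev.vol h)) atTop
          (𝓝 (∫ p, g.gradSq p * η p ∂(RiemSobolev.vol h))) := by
  obtain ⟨g, hfg, hgrad⟩ := RiemSobolev.W12.exists_limit hcauchy
    (RiemSobolev.W12.exists_lintegral_grad_sub_le hcauchy hC hlap)
  refine ⟨g, ?_, fun η hη ↦ RiemSobolev.W12.tendsto_integral_gradSq_mul hgrad hη⟩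
  -- The Sobolev distance is by definition the square root of the sum of these two integrals.
  have h1 := ((ENNReal.continuous_rpow_const (y := 1 / 2)).tendsto (0 + 0)).comp
    (hfg.add hgrad)
  rw [add_zero, ENNReal.zero_rpow_of_pos (by norm_num)] at h1
  exact h1
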